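/- **Setting.** Let $\mathcal X=\mathcal X_l\sqcup\mathcal X_u$ be a finite set of $N_l\ge1$ labeled and $N_u\ge1$ unlabeled points, $N=N_l+N_u$, $1\le k<N$. Let $\mathcal T(\cdot|\bar x)$ be the augmentation probabilities on $\mathcal X$ given a natural sample $\bar x$, $\mathcal P_{l_i}$ ($i\in\mathcal Y_l$) and $\mathcal P_u$ the distributions of natural samples of the known class $i$ and of unlabeled natural samples, $\alpha,\beta\ge0$, and $$w_{xx'}=\alpha\sum_{i\in\mathcal Y_l}\mathbb E_{\bar x_l\sim\mathcal P_{l_i}}\mathbb E_{\bar x_l'\sim\mathcal P_{l_i}}\mathcal T(x|\bar x_l)\mathcal T(x'|\bar x_l')+\beta\,\mathbb E_{\bar x_u\sim\mathcal P_u}\mathcal T(x|\bar x_u)\mathcal T(x'|\bar x_u).$$ Let $w_x=\sum_{x'}w_{xx'}>0$ for all $x$, and $\dot A=D^{-1/2}AD^{-1/2}$ with $A=(w_{xx'})$, $D=\mathrm{diag}(w_x)$; $\sigma_1\ge\dots\ge\sigma_N$ are the eigenvalues of $\dot A$. Let $A_{uu}$ be the unlabeled block of $\dot A$, $\eta_l$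 the mean of the labeled block, and $\vec\eta_u\in\mathbb R^{N_u}$ the vector of row means of the unlabeled-labeled block. Let $\bar A$ be $\dot A$ with the labeled block replaced by the constant $\eta_l$ and the rows of the unlabeled-labeled block by the constants $(\vec\eta_u)_x$ (and symmetrically). Let $\bar V$ be any orthonormal eigenbasis of $\bar A$ with eigenvalues $\bar\sigma_1\ge\dots\ge\bar\sigma_N$, with columns $(\bar l_i,\bar u_i)\in\mathbb R^{N_l}\times\mathbb R^{N_u}$, let $\bar U^\flat,\bar L^\flat$ be the unlabeled and labeled rows of its columns $k+1,\dots,N$, $\bar{\mathfrak l}^\flat=\bar L^{\flat\top}\mathbf 1$, and $$\mathfrak T(\vec y)=\frac{\|\bar U^{\flat\top}\vec y\|_2}{\|\vec y\|_2},\qquad \kappa(\vec y)=\cos(\bar U^{\flat\top}\vec y,\bar{\mathfrak l}^\flat),\qquad \mathcal I=\{i>k:\bar\sigma_i\ne0\},\qquad m=\frac1{|\mathcal I|}\sum_{i\in\mathcal I}(1-\|\bar u_i\|_2^2).$$ Assume $\mathcal I\neq\emptyset$ and $m\ne0$. **(1) Error bound.** Assume $\|\dot A-\bar A\|_2<\tfrac12(\sigma_k-\sigma_{k+1})$.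 Let $f:\mathcal X\to\mathbb R^k$ be such that the matrix $F$ with rows $\sqrt{w_x}f(x)^\top$ minimizes $\|\dot A-FF^\top\|_F^2$ over $\mathbb R^{N\times k}$. Let $\mathcal Y_u$ be the set of novel classes and $\vec y_i\in\{0,1\}^{N_u}$ the indicator vector of class $i$ in $\mathcal X_u$, all classes having $N_u/|\mathcal Y_u|$ points. Let $\mathcal E(f)$ be the least number, over all linear heads $\mathbf M\in\mathbb R^{k\times|\mathcal Y_u|}$, of points $x\in\mathcal X_u$ misclassified by $\operatorname{argmax}_i(f(x)^\top\mathbf M)_i$, for any tie-breaking rule. Then $$\mathcal E(f)\le\frac{2N_u}{|\mathcal Y_u|}\sum_{i\in\mathcal Y_u}\left(\mathfrak T(\vec y_i)\bigl(1-\kappa(\vec y_i)^2\bigr)+2\left(1+\frac{\kappa(\vec y_i)^2\,\mathfrak T(\vec y_i)^2}{|\mathcal I|\,m}\right)\frac{\|\dot A-\bar A\|_2}{\sigma_k-\sigma_{k+1}}\right).$$ **(2) Coverage.** Let $q_1,\dots,q_{N_u}$ be any orthonormal eigenbasis of $A_{uu}$ with eigenvalues $d_1\ge\dots\ge d_{N_u}$,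 let $J=\{j\ge k:d_j>0\}$ and $r_j=\frac{\vec y^\top q_j}{\vec\eta_u^\top q_j}$. For all $g,b,h>0$ and $\tau<1$ there is a constant $C>0$, depending only on $N_l,N_u,k,g,b,h,\tau$, such that the following holds for every graph as above and every $\vec y\in\{0,1\}^{N_u}$ with: $\max_x(\vec\eta_u)_x\le\frac1M$ with $M>0$, $M^2\ge C$; $\eta_l\ge h$; $d_j\le\tau N_l\eta_l$ for all $j\ge k$; for all $j\in J$, $d_j\ge g$, $|d_i-d_j|\ge g$ for all $i\ne j$, $\vec\eta_u^\top q_j\ne0$ and $|\vec y^\top q_j|\ge b$; and $\vec y^\top q_j=0$ whenever $j\ge k$ and $d_j=0$. One has $$|\kappa(\vec y)|\ \ge\ \Bigl(1-\frac C{M^2}\Bigr)\sqrt{1-\tau}\;\min_{i,j\in J}\frac{2\sqrt{r_ir_j}}{|r_i+r_j|},$$ where a pair with $r_ir_j\le0$ contributes $0$. If moreover $\omega_i=\vec y^\top(\bar\sigma_iI-A_{uu})^\dagger\vec\eta_u>0$ for all $i\in\mathcal I$, then $\kappa(\vec y)$ itself is at least the right-hand side. -/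

import Mathlib

open MeasureTheory Matrix

noncomputable section

namespace NCD

/-- The population space: `Nl` labeled points followed by `Nu` unlabeled points. -/
abbrev Point (Nl Nu : ℕ) : Type := Fin Nl ⊕ Fin Nu

/-- The data of the augmentation graph: a space `S` of natural samples, the distributions `Pl c` of
the natural labeled samples of the known classes `c`, the distribution `Pu` of the natural unlabeled
samples, the augmentation probabilities `aug x s` of generating `x` from the natural sample `s`,
and the weights `α`, `β` of the labeled and of the unlabeled part. -/
structure AugData (Nl Nu : ℕ) (Known S : Type*) [MeasurableSpace S] where
  Pl : Known → Measure S
  Pl_prob : ∀ c, IsProbabilityMeasure (Pl c)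
  Pu : Measure S
  Pu_prob : IsProbabilityMeasure Pu
  aug : Point Nl Nu → S → ℝ
  aug_measurable : ∀ x, Measurable (aug x)
  aug_nonneg : ∀ x s, 0 ≤ aug x s
  aug_sum : ∀ s, ∑ x, aug x s = 1
  α : ℝ
  β : ℝ
  α_nonneg : 0 ≤ α
  β_nonneg : 0 ≤ β

section Graph

variable {Nl Nu : ℕ} {Known S : Type*} [Fintype Known] [MeasurableSpace S]

/-- The edge weight `w_{x x'}`, the (weighted) marginal probability of the positive pair. -/
def AugData.weight (G : AugData Nl Nu Known S) (x x' : Point Nl Nu) : ℝ :=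
  G.α * ∑ c, ∫ s, ∫ s', G.aug x s * G.aug x' s' ∂(G.Pl c) ∂(G.Pl c)
    + G.β * ∫ s, G.aug x s * G.aug x' s ∂G.Pu

/-- The degree `w_x`. -/
def AugData.degree (G : AugData Nl Nu Known S) (x : Point Nl Nu) : ℝ :=
  ∑ x', G.weight x x'

/-- The normalized adjacency matrix `D^{-1/2} A D^{-1/2}`. -/
def AugData.normAdj (G : AugData Nl Nu Known S) : Matrix (Point Nl Nu) (Point Nl Nu) ℝ :=
  Matrix.diagonal (fun x => (Real.sqrt (G.degree x))⁻¹) * Matrix.of G.weight *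
    Matrix.diagonal (fun x => (Real.sqrt (G.degree x))⁻¹)

/-- The matrix-factorization loss `‖A - F Fᵀ‖_F²`. -/
def mfLoss {k : ℕ} (A : Matrix (Point Nl Nu) (Point Nl Nu) ℝ)
    (F : Matrix (Point Nl Nu) (Fin k) ℝ) : ℝ :=
  ∑ x, ∑ x', (A x x' - (F * Fᵀ) x x') ^ 2

/-- The scaled embedding with rows `f_x = √w_x f(x)`. -/
def AugData.embed (G : AugData Nl Nu Known S) {k : ℕ} (f : Point Nl Nu → Fin k → ℝ) :
    Matrix (Point Nl Nu) (Fin k) ℝ :=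
  Matrix.of fun x a => Real.sqrt (G.degree x) * f x a

/-- `f` is a learned representation: its scaled embedding minimizes the loss over all
embeddings into `ℝ^k`. -/
def AugData.IsLearned (G : AugData Nl Nu Known S) {k : ℕ} (f : Point Nl Nu → Fin k → ℝ) : Prop :=
  ∀ F : Matrix (Point Nl Nu) (Fin k) ℝ, mfLoss G.normAdj (G.embed f) ≤ mfLoss G.normAdj F

end Graph

/-- The linear probing error on the unlabeled points: the least number of misclassified points over
all linear heads. The function `pick` is the tie-breaking `argmax`. -/
def probingError {Nl Nu k : ℕ} {Y : Type*} [DecidableEq Y] (pick : (Y → ℝ) → Y)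
    (label : Fin Nu → Y) (f : Point Nl Nu → Fin k → ℝ) : ℕ :=
  ⨅ M : Matrix (Fin k) Y ℝ,
    (Finset.univ.filter fun x : Fin Nu => label x ≠ pick (f (Sum.inr x) ᵥ* M)).card

/-- The labeling vector of the class `c`, a column of the one-hot label matrix. -/
def labelVec {Nu : ℕ} {Y : Type*} [DecidableEq Y] (label : Fin Nu → Y) (c : Y) : Fin Nu → ℝ :=
  fun x => if label x = c then 1 else 0

section Spectral

variable {Nl Nu : ℕ}

/-- Spectral decomposition with eigenvalues in decreasing order: the columns of `V` are
orthonormal eigenvectors. For the positive semidefinite matrices considered here this is also the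
singular value decomposition. -/
structure IsSpectral {ι : Type*} [Fintype ι] [DecidableEq ι] {n : ℕ}
    (A : Matrix ι ι ℝ) (σ : Fin n → ℝ) (V : Matrix ι (Fin n) ℝ) : Prop where
  orthonormal : Vᵀ * V = 1
  complete : V * Vᵀ = 1
  eigen : A * V = V * Matrix.diagonal σ
  antitone : Antitone σ

/-- The spectral norm. -/
def specNorm {ι : Type*} [Fintype ι] [DecidableEq ι] (A : Matrix ι ι ℝ) : ℝ :=
  ‖Matrix.toEuclideanCLM (𝕜 := ℝ) A‖

/-- The mean of the labeled-labeled block. -/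
def etaL (A : Matrix (Point Nl Nu) (Point Nl Nu) ℝ) : ℝ :=
  (∑ x' : Fin Nl, ∑ x'' : Fin Nl, A (Sum.inl x') (Sum.inl x'')) / ((Nl : ℝ) * Nl)

/-- The vector of the row means of the unlabeled-labeled block. -/
def etaU (A : Matrix (Point Nl Nu) (Point Nl Nu) ℝ) (x : Fin Nu) : ℝ :=
  (∑ x' : Fin Nl, A (Sum.inr x) (Sum.inl x')) / (Nl : ℝ)

/-- The unlabeled-unlabeled block. -/
def unlabeledBlock (A : Matrix (Point Nl Nu) (Point Nl Nu) ℝ) : Matrix (Fin Nu) (Fin Nu) ℝ :=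
  A.submatrix Sum.inr Sum.inr

/-- The approximation of `A` that averages over the rows and columns of the labeled points. -/
def averaged (A : Matrix (Point Nl Nu) (Point Nl Nu) ℝ) :
    Matrix (Point Nl Nu) (Point Nl Nu) ℝ
  | Sum.inr x, Sum.inr x' => A (Sum.inr x) (Sum.inr x')
  | Sum.inr x, Sum.inl _ => etaU A x
  | Sum.inl _, Sum.inr x => (∑ x' : Fin Nl, A (Sum.inl x') (Sum.inr x)) / (Nl : ℝ)
  | Sum.inl _, Sum.inl _ => etaL A

/-- Euclidean norm of a finite vector. -/
def vnorm {ι : Type*} [Fintype ι] (v : ι → ℝ) : ℝ := Real.sqrt (v ⬝ᵥ v)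

/-- Cosine of the angle between two vectors. -/
def cosine {ι : Type*} [Fintype ι] (v w : ι → ℝ) : ℝ := (v ⬝ᵥ w) / (vnorm v * vnorm w)

/-- Indices of the eigenvectors beyond the top `k`. -/
abbrev Rest (n k : ℕ) : Type := {i : Fin n // k ≤ i.val}

/-- The ignorance vector `U♭ᵀ y`. -/
def ignorance {n : ℕ} (k : ℕ) (V : Matrix (Point Nl Nu) (Fin n) ℝ) (y : Fin Nu → ℝ) :
    Rest n k → ℝ :=
  fun i => ∑ x : Fin Nu, V (Sum.inr x) i.val * y x

/-- The extra knowledge `L♭ᵀ 1`. -/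
def knowledge {n : ℕ} (k : ℕ) (V : Matrix (Point Nl Nu) (Fin n) ℝ) : Rest n k → ℝ :=
  fun i => ∑ x : Fin Nl, V (Sum.inl x) i.val

/-- The ignorance degree `‖U♭ᵀ y‖ / ‖y‖`. -/
def ignoranceDegree {n : ℕ} (k : ℕ) (V : Matrix (Point Nl Nu) (Fin n) ℝ) (y : Fin Nu → ℝ) : ℝ :=
  vnorm (ignorance k V y) / vnorm y

/-- The coverage `κ(y)`. -/
def coverage {n : ℕ} (k : ℕ) (V : Matrix (Point Nl Nu) (Fin n) ℝ) (y : Fin Nu → ℝ) : ℝ :=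
  cosine (ignorance k V y) (knowledge k V)

/-- The indices beyond the top `k` that carry a nonzero eigenvalue. -/
def restSupport {n : ℕ} (k : ℕ) (σ : Fin n → ℝ) : Finset (Fin n) :=
  Finset.univ.filter fun i => k ≤ i.val ∧ σ i ≠ 0

/-- The average of `1 - ‖u_i‖²` over these indices. -/
def labeledMass {n : ℕ} (k : ℕ) (σ : Fin n → ℝ) (V : Matrix (Point Nl Nu) (Fin n) ℝ) : ℝ :=
  (∑ i ∈ restSupport k σ, (1 - ∑ x : Fin Nu, V (Sum.inr x) i ^ 2)) / ((restSupport k σ).card : ℝ)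

/-- The number `ω = yᵀ (s I - B)† η`, written in an orthonormal eigenbasis `Q` of `B` with
eigenvalues `d`; a vanishing denominator gives a vanishing summand, as in the pseudo-inverse. -/
def resolventValue (d : Fin Nu → ℝ) (Q : Matrix (Fin Nu) (Fin Nu) ℝ) (η y : Fin Nu → ℝ)
    (s : ℝ) : ℝ :=
  ∑ j, (y ⬝ᵥ Q.col j) * (η ⬝ᵥ Q.col j) / (s - d j)

/-- The ratio `(yᵀ q_j) / (ηᵀ q_j)`. -/
def eigRatio (Q : Matrix (Fin Nu) (Fin Nu) ℝ) (η y : Fin Nu → ℝ) (j : Fin Nu) : ℝ :=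
  (y ⬝ᵥ Q.col j) / (η ⬝ᵥ Q.col j)

/-- Positions `j ≥ k` (counting from one) with a positive eigenvalue `d_j`. -/
abbrev LowIndex (k : ℕ) (d : Fin Nu → ℝ) : Type := {j : Fin Nu // k ≤ j.val + 1 ∧ 0 < d j}

/-- The minimum of `2 √(r_i r_j) / |r_i + r_j|` over pairs of low positions; a pair of ratios of
opposite signs contributes `0`. -/
def ratioFloor (k : ℕ) (d : Fin Nu → ℝ) (r : Fin Nu → ℝ) : ℝ :=
  ⨅ p : LowIndex k d × LowIndex k d,
    2 * Real.sqrt (r p.1.val * r p.2.val) / |r p.1.val + r p.2.val|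

/-- Quantitative genericity, beyond position `k`, of the unlabeled block (eigenvalues `d`,
eigenvectors `Q`) relative to the labeling vector `y` and the averaged vector `η`: the positive
eigenvalues are at least `g` and `g`-separated from all others, the components of `η` along their
eigenvectors do not vanish and those of `y` are at least `b` in absolute value, and `y` has no
component along null vectors. -/
structure IsGeneric (k : ℕ) (g b : ℝ) (d : Fin Nu → ℝ) (Q : Matrix (Fin Nu) (Fin Nu) ℝ)
    (η y : Fin Nu → ℝ) : Prop where
  lower : ∀ j, k ≤ j.val + 1 → 0 < d j → g ≤ d j
  separated : ∀ i j, k ≤ j.val + 1 → 0 < d j → i ≠ j → g ≤ |d i - d j|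
  eta_ne : ∀ j, k ≤ j.val + 1 → 0 < d j → η ⬝ᵥ Q.col j ≠ 0
  y_lower : ∀ j, k ≤ j.val + 1 → 0 < d j → b ≤ |y ⬝ᵥ Q.col j|
  y_null : ∀ j, k ≤ j.val + 1 → d j = 0 → y ⬝ᵥ Q.col j = 0

end Spectral

end NCD

end

/-! Error bound. A linear head is built by least squares. Each class indicator `y` is extended by a
constant `t` to the labeled points, and the resulting vector `w` is regressed on the columns of `F`.
By Eckart–Young and the eigengap, the column space of `F` contains the top `k` eigenvectors
(`exists_mulVec_eq_col_of_minimizer`), so some head leaves only the energy of `w` beyond position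
`k`; a misclassified point costs at least `1/2` of squared residual (`probingError_le`). Davis–Kahan
(`tail_energy_le`) transfers this energy to the averaged matrix. There it equals `‖a + t b‖²`, with
`a` the ignorance and `b` the knowledge vector, and the best `t` leaves `‖a‖² (1 - κ²)`. The size of
`w` is under control because eigenvectors of nonzero eigenvalues of the averaged matrix are constant
on the labeled points, which bounds `‖b‖` from below (`mul_labeledMass_le`).

Coverage. In an eigenbasis of the unlabeled block, an eigenvector of the averaged matrix with
eigenvalue `s` and labeled sum `S` has coordinates `u_j = S e_j / (s - d_j)`, where `e_j = η ⬝ q_j`.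
Pairing with `y` shows that the ignorance is the knowledge multiplied entrywise by the resolvent
values `ω`, and the Kantorovich inequality (`le_cosine_of_forall_ratio`) bounds the cosine of two
such vectors. Interlacing (`exists_low_index`) puts every relevant nonzero `s` just below some
`d_j`. The secular equation then forces `-Nl e_j² / (s - d_j)` to lie, up to small errors, between
`(1 - τ) Nl η_l` and `Nl η_l`; multiplied by `r_j = y_j / e_j` this is the dominant part of `-Nl ω`,
and the rest has relative size `O(1 / M²)` (`secular_resolvent_bounds`). So `|ω|` is `|r_j|` up to
factors whose extremes have quotient about `1 - τ`, and such a distortion costs a square root in the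
Kantorovich ratio (`kantorovich_ratio_le`). -/

noncomputable section

namespace NCD

/-! ### Euclidean and spectral norms -/

section Norms

variable {ι : Type*} [Fintype ι]

lemma vnorm_eq_norm (v : ι → ℝ) : vnorm v = ‖WithLp.toLp 2 v‖ := by
  rw [vnorm, EuclideanSpace.norm_eq]
  congr 1
  simp [dotProduct, sq]

lemma vnorm_nonneg (v : ι → ℝ) : 0 ≤ vnorm v := Real.sqrt_nonneg _

lemma dotProduct_self_nonneg' (v : ι → ℝ) : 0 ≤ v ⬝ᵥ v :=
  Finset.sum_nonneg fun _ _ => mul_self_nonneg _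

lemma vnorm_sq (v : ι → ℝ) : vnorm v ^ 2 = v ⬝ᵥ v := Real.sq_sqrt (dotProduct_self_nonneg' v)

lemma abs_dotProduct_le (v w : ι → ℝ) : |v ⬝ᵥ w| ≤ vnorm v * vnorm w := by
  have h := abs_real_inner_le_norm (WithLp.toLp 2 w) (WithLp.toLp 2 v)
  rw [EuclideanSpace.inner_toLp_toLp] at h
  rw [vnorm_eq_norm, vnorm_eq_norm, mul_comm]
  simpa using h

lemma vnorm_add_le (v w : ι → ℝ) : vnorm (v + w) ≤ vnorm v + vnorm w := by
  simp only [vnorm_eq_norm, WithLp.toLp_add]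
  exact norm_add_le _ _

variable [DecidableEq ι]

lemma specNorm_nonneg (A : Matrix ι ι ℝ) : 0 ≤ specNorm A := norm_nonneg _

lemma vnorm_mulVec_le (A : Matrix ι ι ℝ) (v : ι → ℝ) :
    vnorm (A *ᵥ v) ≤ specNorm A * vnorm v := by
  simp only [vnorm_eq_norm]
  exact (Matrix.toEuclideanCLM (𝕜 := ℝ) A).le_opNorm (WithLp.toLp 2 v)

lemma specNorm_le {A : Matrix ι ι ℝ} {c : ℝ} (hc : 0 ≤ c)
    (h : ∀ v, vnorm (A *ᵥ v) ≤ c * vnorm v) : specNorm A ≤ c := by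
  refine ContinuousLinearMap.opNorm_le_bound _ hc fun v => ?_
  have := h (WithLp.ofLp v)
  simp only [vnorm_eq_norm] at this
  exact this

lemma specNorm_sub_comm (A B : Matrix ι ι ℝ) : specNorm (A - B) = specNorm (B - A) := by
  unfold specNorm
  rw [map_sub, map_sub, norm_sub_rev]

lemma abs_dotProduct_mulVec_le (A : Matrix ι ι ℝ) (v w : ι → ℝ) :
    |v ⬝ᵥ (A *ᵥ w)| ≤ specNorm A * (vnorm v * vnorm w) := by
  calc _ ≤ vnorm v * vnorm (A *ᵥ w) := abs_dotProduct_le _ _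
    _ ≤ vnorm v * (specNorm A * vnorm w) :=
        mul_le_mul_of_nonneg_left (vnorm_mulVec_le A w) (vnorm_nonneg v)
    _ = _ := by ring

end Norms

/-! ### Functional calculus, variational bounds on eigenvalues, Davis–Kahan -/

section SpectralCalculus

variable {ι : Type*} {n : ℕ}

/-- The matrix with eigenvalues `φ` in the orthonormal basis given by the columns of `V`. -/
def spectralFun (V : Matrix ι (Fin n) ℝ) (φ : Fin n → ℝ) : Matrix ι ι ℝ :=
  V * Matrix.diagonal φ * Vᵀ

lemma spectralFun_sub (V : Matrix ι (Fin n) ℝ) (φ ψ : Fin n → ℝ) :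
    spectralFun V (φ - ψ) = spectralFun V φ - spectralFun V ψ := by
  have : Matrix.diagonal (φ - ψ) = Matrix.diagonal φ - Matrix.diagonal ψ :=
    (Matrix.diagonal_sub φ ψ).symm
  simp only [spectralFun, this, Matrix.mul_sub, Matrix.sub_mul]

variable [Fintype ι]

lemma spectralFun_mulVec (V : Matrix ι (Fin n) ℝ) (φ : Fin n → ℝ) (x : ι → ℝ) :
    spectralFun V φ *ᵥ x = V *ᵥ (fun i => φ i * (Vᵀ *ᵥ x) i) := by
  rw [spectralFun, ← Matrix.mulVec_mulVec, ← Matrix.mulVec_mulVec]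
  congr 1
  funext i
  rw [Matrix.mulVec_diagonal]

lemma dotProduct_spectralFun (V : Matrix ι (Fin n) ℝ) (φ : Fin n → ℝ) (x y : ι → ℝ) :
    x ⬝ᵥ (spectralFun V φ *ᵥ y) = ∑ i, φ i * ((Vᵀ *ᵥ x) i * (Vᵀ *ᵥ y) i) := by
  rw [spectralFun_mulVec, Matrix.dotProduct_mulVec, ← Matrix.mulVec_transpose]
  simp only [dotProduct]
  exact Finset.sum_congr rfl fun i _ => by ring

variable [DecidableEq ι]

namespace IsSpectral

variable {A : Matrix ι ι ℝ} {σ : Fin n → ℝ} {V : Matrix ι (Fin n) ℝ}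

lemma eq_spectralFun (h : IsSpectral A σ V) : A = spectralFun V σ := by
  rw [spectralFun, ← h.eigen, Matrix.mul_assoc, h.complete, Matrix.mul_one]

lemma mul_spectralFun (h : IsSpectral A σ V) (φ ψ : Fin n → ℝ) :
    spectralFun V φ * spectralFun V ψ = spectralFun V (fun i => φ i * ψ i) := by
  simp only [spectralFun]
  rw [← Matrix.diagonal_mul_diagonal]
  calc _ = V * Matrix.diagonal φ * (Vᵀ * V) * Matrix.diagonal ψ * Vᵀ := by
        simp only [Matrix.mul_assoc]
    _ = _ := by rw [h.orthonormal]; simp only [Matrix.mul_assoc, Matrix.one_mul]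

lemma spectralFun_one (h : IsSpectral A σ V) : spectralFun V (fun _ => 1) = 1 := by
  rw [spectralFun, show Matrix.diagonal (fun _ : Fin n => (1 : ℝ)) = 1 from Matrix.diagonal_one, Matrix.mul_one, h.complete]

lemma spectralFun_const (h : IsSpectral A σ V) (c : ℝ) :
    spectralFun V (fun _ => c) = c • 1 := by
  rw [spectralFun, ← h.complete, ← Matrix.smul_one_eq_diagonal]
  simp

lemma dotProduct_transpose (h : IsSpectral A σ V) (x y : ι → ℝ) :
    ∑ i, (Vᵀ *ᵥ x) i * (Vᵀ *ᵥ y) i = x ⬝ᵥ y := by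
  have := dotProduct_spectralFun V (fun _ => 1) x y
  rw [h.spectralFun_one, Matrix.one_mulVec] at this
  simpa using this.symm

lemma transpose_mulVec_mulVec (h : IsSpectral A σ V) (c : Fin n → ℝ) :
    Vᵀ *ᵥ (V *ᵥ c) = c := by
  rw [Matrix.mulVec_mulVec, h.orthonormal, Matrix.one_mulVec]

lemma mulVec_transpose_mulVec (h : IsSpectral A σ V) (x : ι → ℝ) :
    V *ᵥ (Vᵀ *ᵥ x) = x := by
  rw [Matrix.mulVec_mulVec, h.complete, Matrix.one_mulVec]

lemma transpose_spectralFun (h : IsSpectral A σ V) (φ : Fin n → ℝ) (x : ι → ℝ) :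
    Vᵀ *ᵥ (spectralFun V φ *ᵥ x) = fun i => φ i * (Vᵀ *ᵥ x) i := by
  rw [spectralFun_mulVec, h.transpose_mulVec_mulVec]

lemma vnorm_spectralFun_sq (h : IsSpectral A σ V) (φ : Fin n → ℝ) (x : ι → ℝ) :
    vnorm (spectralFun V φ *ᵥ x) ^ 2 = ∑ i, φ i ^ 2 * (Vᵀ *ᵥ x) i ^ 2 := by
  rw [vnorm_sq, ← h.dotProduct_transpose, h.transpose_spectralFun]
  exact Finset.sum_congr rfl fun i _ => by ring

lemma vnorm_sq_eq (h : IsSpectral A σ V) (x : ι → ℝ) :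
    vnorm x ^ 2 = ∑ i, (Vᵀ *ᵥ x) i ^ 2 := by
  rw [vnorm_sq, ← h.dotProduct_transpose]
  exact Finset.sum_congr rfl fun i _ => by ring

lemma vnorm_spectralFun_le (h : IsSpectral A σ V) {φ : Fin n → ℝ} {c : ℝ} (hc : 0 ≤ c)
    (hφ : ∀ i, |φ i| ≤ c) (x : ι → ℝ) : vnorm (spectralFun V φ *ᵥ x) ≤ c * vnorm x := by
  refine le_of_sq_le_sq ?_ (mul_nonneg hc (vnorm_nonneg x))
  rw [h.vnorm_spectralFun_sq, mul_pow, h.vnorm_sq_eq, Finset.mul_sum]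
  exact Finset.sum_le_sum fun i _ =>
    mul_le_mul_of_nonneg_right (sq_le_sq.2 ((hφ i).trans (le_abs_self c))) (sq_nonneg _)

lemma quadForm_eq (h : IsSpectral A σ V) (x : ι → ℝ) :
    x ⬝ᵥ (A *ᵥ x) = ∑ i, σ i * (Vᵀ *ᵥ x) i ^ 2 := by
  conv_lhs => rw [h.eq_spectralFun, dotProduct_spectralFun]
  exact Finset.sum_congr rfl fun i _ => by ring

lemma mulVec_col (h : IsSpectral A σ V) (i : Fin n) : A *ᵥ V.col i = σ i • V.col i := by
  funext x
  have := congr_fun (congr_fun h.eigen x) i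
  rw [Matrix.mul_diagonal] at this
  simp only [Pi.smul_apply, smul_eq_mul, Matrix.col_apply]
  rw [mul_comm, ← this]
  rfl

lemma dotProduct_col (h : IsSpectral A σ V) (i j : Fin n) :
    V.col i ⬝ᵥ V.col j = if i = j then 1 else 0 := by
  have := congr_fun (congr_fun h.orthonormal i) j
  rw [Matrix.one_apply] at this
  exact this

lemma eigenvalue_nonneg (h : IsSpectral A σ V) (hA : ∀ x, 0 ≤ x ⬝ᵥ (A *ᵥ x)) (i : Fin n) :
    0 ≤ σ i := by
  have := hA (V.col i)
  rw [h.mulVec_col, dotProduct_smul, h.dotProduct_col] at this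
  simpa using this

/-- The lower Courant–Fischer bound. -/
lemma le_eigenvalue (h : IsSpectral A σ V) {κ : Type*} [Fintype κ] (i : Fin n)
    (hκ : i.val < Fintype.card κ) (T : (κ → ℝ) →ₗ[ℝ] (ι → ℝ)) (hT : ∀ c, T c = 0 → c = 0)
    {μ : ℝ} (hμ : ∀ c, μ * vnorm (T c) ^ 2 ≤ T c ⬝ᵥ (A *ᵥ T c)) : μ ≤ σ i := by
  classical
  -- `L` reads the coordinates along the first `i` eigenvectors. As `κ` has more than `i` elements,
  -- it kills some nonzero `c`, and at `T c` the form is at most `σ i` times the squared norm.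
  let L : (κ → ℝ) →ₗ[ℝ] (Fin i.val → ℝ) :=
    LinearMap.pi fun j => (LinearMap.proj (Fin.castLE i.isLt.le j)).comp
      ((Matrix.mulVecLin Vᵀ).comp T)
  have hL : LinearMap.ker L ≠ ⊥ := LinearMap.ker_ne_bot_of_finrank_lt (by simpa using hκ)
  obtain ⟨c, hc, hc0⟩ := (Submodule.ne_bot_iff _).1 hL
  have hz : ∀ j : Fin n, j < i → (Vᵀ *ᵥ T c) j = 0 := fun j hj =>
    congr_fun (LinearMap.mem_ker.1 hc) ⟨j.val, hj⟩
  have hx : 0 < vnorm (T c) ^ 2 := by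
    rw [vnorm_sq]
    exact lt_of_le_of_ne (dotProduct_self_nonneg' _)
      fun h0 => hc0 (hT c (dotProduct_self_eq_zero.1 h0.symm))
  have h1 := hμ c
  rw [h.quadForm_eq] at h1
  have h2 : ∑ j, σ j * (Vᵀ *ᵥ T c) j ^ 2 ≤ σ i * vnorm (T c) ^ 2 := by
    rw [h.vnorm_sq_eq, Finset.mul_sum]
    refine Finset.sum_le_sum fun j _ => ?_
    rcases lt_or_ge j i with hj | hj
    · rw [hz j hj]; simp
    · exact mul_le_mul_of_nonneg_right (h.antitone hj) (sq_nonneg _)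
  exact le_of_mul_le_mul_right (h1.trans h2) hx

/-- The upper Courant–Fischer bound. -/
lemma eigenvalue_le (h : IsSpectral A σ V) {κ : Type*} [Fintype κ] (i : Fin n)
    (hκ : Fintype.card κ ≤ i.val) (L : (ι → ℝ) →ₗ[ℝ] (κ → ℝ))
    {μ : ℝ} (hμ : ∀ x, L x = 0 → x ⬝ᵥ (A *ᵥ x) ≤ μ * vnorm x ^ 2) : σ i ≤ μ := by
  classical
  -- The span of the first `i + 1` eigenvectors meets the kernel of `L`, and on it the form is at
  -- least `σ i` times the squared norm.
  let T : (Fin (i.val + 1) → ℝ) →ₗ[ℝ] (ι → ℝ) :=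
    Matrix.mulVecLin (V.submatrix id (Fin.castLE i.isLt))
  have hL : LinearMap.ker (L.comp T) ≠ ⊥ :=
    LinearMap.ker_ne_bot_of_finrank_lt (by simpa using Nat.lt_succ_of_le hκ)
  obtain ⟨c, hc, hc0⟩ := (Submodule.ne_bot_iff _).1 hL
  have hVT : ∀ j, (Vᵀ *ᵥ T c) j = if hj : j.val < i.val + 1 then c ⟨j.val, hj⟩ else 0 := by
    intro j
    have h1 : T c = ∑ a, c a • V.col (Fin.castLE i.isLt a) := by
      funext x
      simp [T, Matrix.mulVec, dotProduct, mul_comm]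
    have h2 : (Vᵀ *ᵥ T c) j = V.col j ⬝ᵥ T c := rfl
    rw [h2, h1, dotProduct_sum]
    simp only [dotProduct_smul, h.dotProduct_col, smul_eq_mul, mul_ite, mul_one, mul_zero]
    split_ifs with hj
    · rw [Finset.sum_eq_single ⟨j.val, hj⟩]
      · simp
      · intro b _ hb
        rw [if_neg]
        intro hjb
        exact hb (Fin.ext (by simp [hjb]))
      · simp
    · refine Finset.sum_eq_zero fun b _ => if_neg fun hjb => hj ?_
      rw [hjb]
      exact b.isLt
  have h1 := hμ (T c) (LinearMap.mem_ker.1 hc)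
  have hx : 0 < vnorm (T c) ^ 2 := by
    rw [h.vnorm_sq_eq]
    obtain ⟨a, ha⟩ := Function.ne_iff.1 hc0
    refine Finset.sum_pos' (fun _ _ => sq_nonneg _) ⟨Fin.castLE i.isLt a, Finset.mem_univ _, ?_⟩
    rw [hVT, dif_pos (by exact a.isLt)]
    exact sq_pos_of_ne_zero ha
  rw [h.quadForm_eq] at h1
  have h2 : σ i * vnorm (T c) ^ 2 ≤ ∑ j, σ j * (Vᵀ *ᵥ T c) j ^ 2 := by
    rw [h.vnorm_sq_eq, Finset.mul_sum]
    refine Finset.sum_le_sum fun j _ => ?_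
    by_cases hj : j.val < i.val + 1
    · exact mul_le_mul_of_nonneg_right (h.antitone (Fin.le_def.2 (by omega))) (sq_nonneg _)
    · rw [hVT, dif_neg hj]; simp
  exact le_of_mul_le_mul_right (h2.trans h1) hx

/-- Weyl's inequality. -/
lemma eigenvalue_le_add (h : IsSpectral A σ V) {B : Matrix ι ι ℝ} {σ' : Fin n → ℝ}
    {V' : Matrix ι (Fin n) ℝ} (h' : IsSpectral B σ' V') (i : Fin n) :
    σ i ≤ σ' i + specNorm (A - B) := by
  -- The test vectors are those orthogonal to the first `i` eigenvectors of `B`.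
  refine h.eigenvalue_le i (by simp) (LinearMap.pi fun j : Fin i.val =>
    (LinearMap.proj (Fin.castLE i.isLt.le j)).comp (Matrix.mulVecLin V'ᵀ)) fun x hx => ?_
  have hz : ∀ j : Fin n, j < i → (V'ᵀ *ᵥ x) j = 0 := fun j hj => congr_fun hx ⟨j.val, hj⟩
  have h1 : x ⬝ᵥ (B *ᵥ x) ≤ σ' i * vnorm x ^ 2 := by
    rw [h'.quadForm_eq, h'.vnorm_sq_eq, Finset.mul_sum]
    refine Finset.sum_le_sum fun j _ => ?_
    rcases lt_or_ge j i with hj | hj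
    · rw [hz j hj]; simp
    · exact mul_le_mul_of_nonneg_right (h'.antitone hj) (sq_nonneg _)
  have h2 := (le_abs_self _).trans (abs_dotProduct_mulVec_le (A - B) x x)
  rw [Matrix.sub_mulVec, dotProduct_sub] at h2
  nlinarith

/-- The Davis–Kahan bound for spectral subsets, one in an interval and the other outside a larger
one. -/
lemma specNorm_proj_mul_proj_le (h : IsSpectral A σ V) {B : Matrix ι ι ℝ} {σ' : Fin n → ℝ}
    {V' : Matrix ι (Fin n) ℝ} (h' : IsSpectral B σ' V') (s t : Set (Fin n)) {c r γ : ℝ}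
    (hr : 0 ≤ r) (hγ : 0 < γ) (hs : ∀ i ∈ s, |σ i - c| ≤ r) (ht : ∀ i ∈ t, r + γ ≤ σ' i - c) :
    specNorm (spectralFun V (s.indicator 1) * spectralFun V' (t.indicator 1))
      ≤ specNorm (A - B) / γ := by
  classical
  set P := spectralFun V (s.indicator 1)
  set Q := spectralFun V' (t.indicator 1)
  -- `R` inverts `B - c` on the range of `Q` and has norm at most `1 / (r + γ)`.
  set ψ : Fin n → ℝ := t.indicator fun i => (σ' i - c)⁻¹
  set R := spectralFun V' ψ
  have hrγ : 0 < r + γ := by linarith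
  have hBR : Q = (B - c • 1) * R := by
    rw [h'.eq_spectralFun, ← h'.spectralFun_const, ← spectralFun_sub, h'.mul_spectralFun]
    refine congrArg (spectralFun V') (funext fun i => ?_)
    by_cases hi : i ∈ t
    · have : σ' i - c ≠ 0 := (hrγ.trans_le (ht i hi)).ne'
      simp [ψ, hi, this]
    · simp [ψ, hi]
  have hQR : Q * R = R := by
    rw [h'.mul_spectralFun]
    congr 1
    funext i
    by_cases hi : i ∈ t <;> simp [ψ, hi]
  have hPA : P * (A - c • 1) = spectralFun V (s.indicator fun i => σ i - c) * P := by
    rw [h.eq_spectralFun, ← h.spectralFun_const, ← spectralFun_sub, h.mul_spectralFun,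
      h.mul_spectralFun]
    congr 1
    funext i
    by_cases hi : i ∈ s <;> simp [hi]
  have hP1 : ∀ x, vnorm (P *ᵥ x) ≤ vnorm x := fun x => by
    refine (h.vnorm_spectralFun_le zero_le_one (fun i => ?_) x).trans (one_mul _).le
    by_cases hi : i ∈ s <;> simp [hi]
  have hR1 : ∀ x, vnorm (R *ᵥ x) ≤ (r + γ)⁻¹ * vnorm x := fun x => by
    refine h'.vnorm_spectralFun_le (inv_nonneg.2 hrγ.le) (fun i => ?_) x
    by_cases hi : i ∈ t
    · have := ht i hi
      simp only [ψ, Set.indicator_of_mem hi]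
      rw [abs_inv, abs_of_pos (hrγ.trans_le this)]
      exact inv_anti₀ hrγ this
    · simp [ψ, hi, hrγ.le]
  have hS1 : ∀ x, vnorm (spectralFun V (s.indicator fun i => σ i - c) *ᵥ x) ≤ r * vnorm x :=
    fun x => by
      refine h.vnorm_spectralFun_le hr (fun i => ?_) x
      by_cases hi : i ∈ s
      · simpa [hi] using hs i hi
      · simp [hi, hr]
  -- Split `B - c = (B - A) + (A - c)`; on the range of `P` the second part has norm at most `r`. So
  -- `‖P * Q‖` appears on both sides, and solving for it turns `r + γ` into `γ`.
  have hkey : P * Q = P * ((B - A) * R) +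
      spectralFun V (s.indicator fun i => σ i - c) * ((P * Q) * R) := by
    rw [Matrix.mul_assoc P Q R, hQR, ← Matrix.mul_assoc _ P R, ← hPA, Matrix.mul_assoc,
      ← Matrix.mul_add, ← Matrix.add_mul, hBR]
    congr 2
    abel
  have hfin : specNorm (P * Q) ≤ (specNorm (A - B) + r * specNorm (P * Q)) * (r + γ)⁻¹ := by
    refine specNorm_le (mul_nonneg (add_nonneg (specNorm_nonneg _)
      (mul_nonneg hr (specNorm_nonneg _))) (inv_nonneg.2 hrγ.le)) fun x => ?_
    conv_lhs => rw [hkey]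
    rw [Matrix.add_mulVec]
    simp only [← Matrix.mulVec_mulVec]
    refine (vnorm_add_le _ _).trans ?_
    have e1 := (hP1 ((B - A) *ᵥ R *ᵥ x)).trans (vnorm_mulVec_le (B - A) (R *ᵥ x))
    have e2 := (hS1 (P *ᵥ Q *ᵥ R *ᵥ x))
    have e3 := vnorm_mulVec_le (P * Q) (R *ᵥ x)
    rw [← Matrix.mulVec_mulVec] at e3
    have e4 := hR1 x
    rw [specNorm_sub_comm] at e1
    have e5 := mul_le_mul_of_nonneg_left e3 hr
    have e6 := mul_le_mul_of_nonneg_left e4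
      (add_nonneg (specNorm_nonneg (A - B)) (mul_nonneg hr (specNorm_nonneg (P * Q))))
    nlinarith
  rw [← div_eq_mul_inv, le_div_iff₀ hrγ] at hfin
  rw [le_div_iff₀ hγ]
  linarith

end IsSpectral

end SpectralCalculus

/-! ### Symmetry and positivity of the augmentation graph -/

section GraphLemmas

lemma AugData.aug_le_one {Nl Nu : ℕ} {Known S : Type*} [MeasurableSpace S]
    (G : AugData Nl Nu Known S) (x : Point Nl Nu) (s : S) : G.aug x s ≤ 1 := by
  rw [← G.aug_sum s]
  exact Finset.single_le_sum (f := fun x => G.aug x s) (fun i _ => G.aug_nonneg i s)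
    (Finset.mem_univ x)

variable {Nl Nu : ℕ} {Known S : Type*} [Fintype Known] [MeasurableSpace S]

namespace AugData

lemma weight_eq (G : AugData Nl Nu Known S) (x x' : Point Nl Nu) :
    G.weight x x' = G.α * ∑ c, (∫ s, G.aug x s ∂(G.Pl c)) * (∫ s, G.aug x' s ∂(G.Pl c))
      + G.β * ∫ s, G.aug x s * G.aug x' s ∂G.Pu := by
  simp only [weight, integral_const_mul, integral_mul_const]

lemma weight_comm (G : AugData Nl Nu Known S) (x x' : Point Nl Nu) :
    G.weight x x' = G.weight x' x := by
  simp only [weight_eq, mul_comm]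

lemma weight_nonneg (G : AugData Nl Nu Known S) (x x' : Point Nl Nu) : 0 ≤ G.weight x x' := by
  rw [weight_eq]
  have h : ∀ c (z : Point Nl Nu), 0 ≤ ∫ s, G.aug z s ∂(G.Pl c) :=
    fun c z => integral_nonneg fun s => G.aug_nonneg z s
  have h' : 0 ≤ ∫ s, G.aug x s * G.aug x' s ∂G.Pu :=
    integral_nonneg fun s => mul_nonneg (G.aug_nonneg x s) (G.aug_nonneg x' s)
  exact add_nonneg (mul_nonneg G.α_nonneg
    (Finset.sum_nonneg fun c _ => mul_nonneg (h c x) (h c x'))) (mul_nonneg G.β_nonneg h')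

/-- The weights are a nonnegative combination of Gram matrices: the rank-one matrices of the class
means of `aug`, and the second moments of `aug` under `Pu`. -/
lemma weight_quadForm_nonneg (G : AugData Nl Nu Known S) (v : Point Nl Nu → ℝ) :
    0 ≤ ∑ x, ∑ x', v x * v x' * G.weight x x' := by
  have hPu := G.Pu_prob
  have hint : ∀ x x', Integrable (fun s => G.aug x s * G.aug x' s) G.Pu := fun x x' =>
    Integrable.of_bound ((G.aug_measurable x).mul (G.aug_measurable x')).aestronglyMeasurable 1
      (Filter.Eventually.of_forall fun s => by
        rw [Real.norm_of_nonneg (mul_nonneg (G.aug_nonneg x s) (G.aug_nonneg x' s))]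
        exact mul_le_one₀ (G.aug_le_one x s) (G.aug_nonneg x' s) (G.aug_le_one x' s))
  have h1 : ∑ x, ∑ x', v x * v x' * ∫ s, G.aug x s * G.aug x' s ∂G.Pu
      = ∫ s, (∑ x, v x * G.aug x s) ^ 2 ∂G.Pu := by
    have h : ∀ s, (∑ x, v x * G.aug x s) ^ 2
        = ∑ x, ∑ x', v x * v x' * (G.aug x s * G.aug x' s) := fun s => by
      rw [sq, Finset.sum_mul_sum]
      exact Finset.sum_congr rfl fun x _ => Finset.sum_congr rfl fun x' _ => by ring
    simp only [h]
    rw [integral_finsetSum _ fun x _ => integrable_finsetSum _ fun x' _ =>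
      (hint x x').const_mul _]
    refine Finset.sum_congr rfl fun x _ => ?_
    rw [integral_finsetSum _ fun x' _ => (hint x x').const_mul _]
    exact Finset.sum_congr rfl fun x' _ => (integral_const_mul _ _).symm
  have h2 : ∑ x, ∑ x', v x * v x' *
      ∑ c, (∫ s, G.aug x s ∂(G.Pl c)) * (∫ s, G.aug x' s ∂(G.Pl c))
      = ∑ c, (∑ x, v x * ∫ s, G.aug x s ∂(G.Pl c)) ^ 2 := by
    simp only [sq, Finset.sum_mul_sum]
    simp only [Finset.mul_sum]
    rw [Finset.sum_comm (γ := Known)]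
    refine Finset.sum_congr rfl fun x _ => ?_
    rw [Finset.sum_comm (γ := Known)]
    exact Finset.sum_congr rfl fun x' _ => Finset.sum_congr rfl fun c _ => by ring
  have h3 : ∑ x, ∑ x', v x * v x' * G.weight x x'
      = G.α * ∑ c, (∑ x, v x * ∫ s, G.aug x s ∂(G.Pl c)) ^ 2
        + G.β * ∫ s, (∑ x, v x * G.aug x s) ^ 2 ∂G.Pu := by
    rw [← h1, ← h2, Finset.mul_sum, Finset.mul_sum, ← Finset.sum_add_distrib]
    refine Finset.sum_congr rfl fun x _ => ?_
    rw [Finset.mul_sum, Finset.mul_sum, ← Finset.sum_add_distrib]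
    refine Finset.sum_congr rfl fun x' _ => ?_
    rw [weight_eq]
    ring
  rw [h3]
  exact add_nonneg (mul_nonneg G.α_nonneg (Finset.sum_nonneg fun _ _ => sq_nonneg _))
    (mul_nonneg G.β_nonneg (integral_nonneg fun _ => sq_nonneg _))

lemma normAdj_apply (G : AugData Nl Nu Known S) (x x' : Point Nl Nu) :
    G.normAdj x x' = (Real.sqrt (G.degree x))⁻¹ * G.weight x x' * (Real.sqrt (G.degree x'))⁻¹ := by
  rw [normAdj, Matrix.mul_diagonal, Matrix.diagonal_mul, Matrix.of_apply]

lemma normAdj_transpose (G : AugData Nl Nu Known S) : G.normAdjᵀ = G.normAdj := by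
  ext x x'
  rw [Matrix.transpose_apply, normAdj_apply, normAdj_apply, G.weight_comm x']
  ring

lemma normAdj_nonneg (G : AugData Nl Nu Known S) (x x' : Point Nl Nu) : 0 ≤ G.normAdj x x' := by
  rw [normAdj_apply]
  exact mul_nonneg (mul_nonneg (inv_nonneg.2 (Real.sqrt_nonneg _)) (G.weight_nonneg x x'))
    (inv_nonneg.2 (Real.sqrt_nonneg _))

lemma normAdj_quadForm_nonneg (G : AugData Nl Nu Known S) (v : Point Nl Nu → ℝ) :
    0 ≤ v ⬝ᵥ (G.normAdj *ᵥ v) := by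
  have h := G.weight_quadForm_nonneg fun x => v x * (Real.sqrt (G.degree x))⁻¹
  convert h using 1
  simp only [dotProduct, Matrix.mulVec, Finset.mul_sum, normAdj_apply]
  exact Finset.sum_congr rfl fun x _ => Finset.sum_congr rfl fun x' _ => by ring

lemma etaU_normAdj_nonneg (G : AugData Nl Nu Known S) (x : Fin Nu) : 0 ≤ etaU G.normAdj x :=
  div_nonneg (Finset.sum_nonneg fun _ _ => G.normAdj_nonneg _ _) (Nat.cast_nonneg _)

end AugData

end GraphLemmas

/-! ### The averaged matrix -/

section Averaged

variable {Nl Nu : ℕ} {A : Matrix (Point Nl Nu) (Point Nl Nu) ℝ}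

/-- The sum over the labeled points. -/
def labeledSum (x : Point Nl Nu → ℝ) : ℝ := ∑ p : Fin Nl, x (Sum.inl p)

/-- The restriction to the unlabeled points. -/
def unlabeledPart (x : Point Nl Nu → ℝ) : Fin Nu → ℝ := fun p => x (Sum.inr p)

lemma averaged_mulVec_inl (hA : Aᵀ = A) (x : Point Nl Nu → ℝ) (p : Fin Nl) :
    (averaged A *ᵥ x) (Sum.inl p) = etaU A ⬝ᵥ unlabeledPart x + etaL A * labeledSum x := by
  have hs : ∀ p q, A p q = A q p := fun p q => congr_fun (congr_fun hA q) p
  simp only [Matrix.mulVec, dotProduct, Fintype.sum_sum_type, averaged, labeledSum,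
    unlabeledPart, etaU, Finset.mul_sum]
  rw [add_comm]
  congr 1
  refine Finset.sum_congr rfl fun q _ => ?_
  simp only [hs (Sum.inr q)]

lemma averaged_mulVec_inr (x : Point Nl Nu → ℝ) (p : Fin Nu) :
    (averaged A *ᵥ x) (Sum.inr p)
      = (unlabeledBlock A *ᵥ unlabeledPart x) p + labeledSum x * etaU A p := by
  simp only [Matrix.mulVec, dotProduct, Fintype.sum_sum_type, averaged, labeledSum,
    unlabeledPart, unlabeledBlock, Finset.sum_mul, Matrix.submatrix_apply]
  rw [add_comm]
  congr 1
  exact Finset.sum_congr rfl fun q _ => mul_comm _ _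

/-- The averaged matrix sees a vector only through its sum over the labeled points and its unlabeled
part. -/
lemma averaged_quadForm (hA : Aᵀ = A) (x : Point Nl Nu → ℝ) :
    x ⬝ᵥ (averaged A *ᵥ x) = unlabeledPart x ⬝ᵥ (unlabeledBlock A *ᵥ unlabeledPart x)
      + 2 * labeledSum x * (etaU A ⬝ᵥ unlabeledPart x) + etaL A * labeledSum x ^ 2 := by
  have h : x ⬝ᵥ (averaged A *ᵥ x) = ∑ p : Fin Nl, x (Sum.inl p) * (averaged A *ᵥ x) (Sum.inl p)
      + ∑ p : Fin Nu, x (Sum.inr p) * (averaged A *ᵥ x) (Sum.inr p) := by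
    rw [dotProduct, Fintype.sum_sum_type]
  rw [h]
  simp only [averaged_mulVec_inl hA, averaged_mulVec_inr, mul_add, Finset.sum_add_distrib]
  simp only [← mul_add, ← Finset.sum_mul]
  have h1 : ∑ p : Fin Nu, x (Sum.inr p) * (unlabeledBlock A *ᵥ unlabeledPart x) p
      = unlabeledPart x ⬝ᵥ (unlabeledBlock A *ᵥ unlabeledPart x) := rfl
  have h2 : ∑ p : Fin Nu, x (Sum.inr p) * (labeledSum x * etaU A p)
      = labeledSum x * (etaU A ⬝ᵥ unlabeledPart x) := by
    rw [dotProduct, Finset.mul_sum]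
    exact Finset.sum_congr rfl fun q _ => by simp only [unlabeledPart]; ring
  rw [h1, h2]
  simp only [labeledSum]
  ring

lemma quadForm_sumElim_const (hNl : 0 < Nl) (hA : Aᵀ = A) (t : ℝ) (u : Fin Nu → ℝ) :
    Sum.elim (fun _ => t) u ⬝ᵥ (A *ᵥ Sum.elim (fun _ => t) u)
      = u ⬝ᵥ (unlabeledBlock A *ᵥ u) + 2 * (Nl * t) * (etaU A ⬝ᵥ u)
        + etaL A * (Nl * t) ^ 2 := by
  have hs : ∀ p q, A p q = A q p := fun p q => congr_fun (congr_fun hA q) p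
  have hN : (Nl : ℝ) ≠ 0 := by exact_mod_cast hNl.ne'
  have hL : ∑ p : Fin Nl, ∑ q : Fin Nl, A (Sum.inl p) (Sum.inl q) = etaL A * (Nl * Nl) := by
    rw [etaL]; field_simp
  have hU : ∀ p, ∑ q : Fin Nl, A (Sum.inr p) (Sum.inl q) = etaU A p * Nl := fun p => by
    rw [etaU]; field_simp
  have e1 : ∑ p : Fin Nl, ∑ q : Fin Nl, t * (A (Sum.inl p) (Sum.inl q) * t)
      = t * (etaL A * (Nl * Nl)) * t := by
    rw [← hL, Finset.mul_sum, Finset.sum_mul]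
    refine Finset.sum_congr rfl fun p _ => ?_
    rw [Finset.mul_sum, Finset.sum_mul]
    exact Finset.sum_congr rfl fun q _ => by ring
  have e2 : ∑ p : Fin Nu, ∑ q : Fin Nl, u p * (A (Sum.inr p) (Sum.inl q) * t)
      = Nl * t * (etaU A ⬝ᵥ u) := by
    rw [dotProduct, Finset.mul_sum]
    refine Finset.sum_congr rfl fun p _ => ?_
    rw [show (Nl : ℝ) * t * (etaU A p * u p) = u p * (etaU A p * Nl * t) by ring, ← hU,
      Finset.sum_mul, Finset.mul_sum]
  have e3 : ∑ p : Fin Nl, ∑ q : Fin Nu, t * (A (Sum.inl p) (Sum.inr q) * u q)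
      = Nl * t * (etaU A ⬝ᵥ u) := by
    rw [← e2, Finset.sum_comm]
    refine Finset.sum_congr rfl fun p _ => Finset.sum_congr rfl fun q _ => ?_
    rw [hs (Sum.inl q)]
    ring
  have e4 : ∑ p : Fin Nu, ∑ q : Fin Nu, u p * (A (Sum.inr p) (Sum.inr q) * u q)
      = u ⬝ᵥ (unlabeledBlock A *ᵥ u) := by
    simp only [dotProduct, Matrix.mulVec, Finset.mul_sum, unlabeledBlock,
      Matrix.submatrix_apply]
  have h : Sum.elim (fun _ => t) u ⬝ᵥ (A *ᵥ Sum.elim (fun _ => t) u)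
      = (∑ p : Fin Nl, ∑ q : Fin Nl, t * (A (Sum.inl p) (Sum.inl q) * t)
        + ∑ p : Fin Nl, ∑ q : Fin Nu, t * (A (Sum.inl p) (Sum.inr q) * u q))
        + (∑ p : Fin Nu, ∑ q : Fin Nl, u p * (A (Sum.inr p) (Sum.inl q) * t)
        + ∑ p : Fin Nu, ∑ q : Fin Nu, u p * (A (Sum.inr p) (Sum.inr q) * u q)) := by
    simp only [Matrix.mulVec, dotProduct, Fintype.sum_sum_type, Sum.elim_inl, Sum.elim_inr,
      mul_add, Finset.sum_add_distrib, Finset.mul_sum]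
    exact add_add_add_comm _ _ _ _
  rw [h, e1, e3, e2, e4]
  ring

/-- Averaging compresses `A` by the orthogonal projection that replaces the labeled coordinates by
their mean, and a compression keeps positivity. -/
lemma averaged_quadForm_nonneg (hNl : 0 < Nl) (hA : Aᵀ = A) (hpos : ∀ x, 0 ≤ x ⬝ᵥ (A *ᵥ x))
    (x : Point Nl Nu → ℝ) : 0 ≤ x ⬝ᵥ (averaged A *ᵥ x) := by
  have hN : (Nl : ℝ) ≠ 0 := by exact_mod_cast hNl.ne'
  have h := hpos (Sum.elim (fun _ => labeledSum x / Nl) (unlabeledPart x))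
  rw [quadForm_sumElim_const hNl hA, mul_div_cancel₀ _ hN] at h
  rw [averaged_quadForm hA]
  exact h

lemma unlabeledBlock_quadForm_nonneg (hNl : 0 < Nl) (hA : Aᵀ = A)
    (hpos : ∀ x, 0 ≤ x ⬝ᵥ (A *ᵥ x)) (u : Fin Nu → ℝ) : 0 ≤ u ⬝ᵥ (unlabeledBlock A *ᵥ u) := by
  have h := hpos (Sum.elim (fun _ => 0) u)
  rw [quadForm_sumElim_const hNl hA] at h
  simpa using h

lemma vnorm_sq_sum (x : Point Nl Nu → ℝ) :
    vnorm x ^ 2 = ∑ p : Fin Nl, x (Sum.inl p) ^ 2 + vnorm (unlabeledPart x) ^ 2 := by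
  simp only [vnorm_sq, dotProduct, Fintype.sum_sum_type, unlabeledPart, ← sq]

end Averaged

/-! ### Minimizers of the factorization loss -/

section EckartYoung

variable {ι : Type*} [Fintype ι]

/-- An orthonormal basis of the column space. -/
lemma exists_orthonormal_columns {k : ℕ} (F : Matrix ι (Fin k) ℝ) :
    ∃ r ≤ k, ∃ G : Matrix ι (Fin r) ℝ, Gᵀ * G = 1 ∧
      (∃ H : Matrix (Fin r) (Fin k) ℝ, F = G * H) ∧ ∃ H : Matrix (Fin k) (Fin r) ℝ, G = F * H := by
  classical
  let f : Fin k → EuclideanSpace ℝ ι := fun a => WithLp.toLp 2 (F.col a)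
  obtain ⟨W, hW⟩ : ∃ W, W = Submodule.span ℝ (Set.range f) := ⟨_, rfl⟩
  -- The columns of `F` may be dependent, so `r` can be less than `k`.
  obtain ⟨r, hr, ⟨b⟩⟩ : ∃ r ≤ k, Nonempty (OrthonormalBasis (Fin r) ℝ W) := by
    refine ⟨Module.finrank ℝ W, ?_, ⟨stdOrthonormalBasis ℝ W⟩⟩
    rw [hW]
    exact (finrank_range_le_card f).trans (Fintype.card_fin k).le
  refine ⟨r, hr, Matrix.of fun x j => (b j : EuclideanSpace ℝ ι) x, ?_, ?_, ?_⟩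
  · ext i j
    have h := orthonormal_iff_ite.1 b.orthonormal i j
    rw [Submodule.coe_inner, PiLp.inner_apply] at h
    rw [Matrix.one_apply, ← h, Matrix.mul_apply]
    exact Finset.sum_congr rfl fun x _ => mul_comm _ _
  · have hf : ∀ a, f a ∈ W := fun a => hW ▸ Submodule.subset_span ⟨a, rfl⟩
    refine ⟨Matrix.of fun j a => b.repr ⟨f a, hf a⟩ j, ?_⟩
    ext x a
    have h := congr_arg (fun w : W => (w : EuclideanSpace ℝ ι) x) (b.sum_repr ⟨f a, hf a⟩)
    simp only [Submodule.coe_sum, Submodule.coe_smul, WithLp.ofLp_sum, Finset.sum_apply,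
      WithLp.ofLp_smul, Pi.smul_apply, smul_eq_mul] at h
    rw [Matrix.mul_apply]
    simp only [Matrix.of_apply]
    rw [show F x a = f a x from rfl, ← h]
    exact Finset.sum_congr rfl fun j _ => mul_comm _ _
  · have hb : ∀ j, ∃ c : Fin k → ℝ, ∑ a, c a • f a = (b j : EuclideanSpace ℝ ι) := fun j =>
      (Submodule.mem_span_range_iff_exists_fun ℝ).1 (hW ▸ (b j).2)
    choose c hc using hb
    refine ⟨Matrix.of fun a j => c j a, ?_⟩
    ext x j
    rw [Matrix.mul_apply, Matrix.of_apply, ← hc j]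
    simp only [WithLp.ofLp_sum, Finset.sum_apply, WithLp.ofLp_smul, Pi.smul_apply, smul_eq_mul,
      Matrix.of_apply]
    exact Finset.sum_congr rfl fun a _ => mul_comm _ _

/-- Pythagoras for the projection `G * Gᵀ`; the last term measures how far `c` is from the best
coefficients. -/
lemma vnorm_sub_mulVec_sq {r : ℕ} {G : Matrix ι (Fin r) ℝ} (hG : Gᵀ * G = 1) (v : ι → ℝ)
    (c : Fin r → ℝ) :
    vnorm (v - G *ᵥ c) ^ 2 = vnorm v ^ 2 - vnorm (Gᵀ *ᵥ v) ^ 2 + vnorm (Gᵀ *ᵥ v - c) ^ 2 := by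
  simp only [vnorm_sq, sub_dotProduct, dotProduct_sub]
  have h1 : v ⬝ᵥ (G *ᵥ c) = (Gᵀ *ᵥ v) ⬝ᵥ c := by
    rw [Matrix.dotProduct_mulVec, Matrix.mulVec_transpose]
  have h2 : (G *ᵥ c) ⬝ᵥ (G *ᵥ c) = c ⬝ᵥ c := by
    rw [Matrix.dotProduct_mulVec, ← Matrix.mulVec_transpose, Matrix.mulVec_mulVec, hG,
      Matrix.one_mulVec]
  rw [dotProduct_comm (G *ᵥ c) v, h1, h2, dotProduct_comm c (Gᵀ *ᵥ v)]
  ring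

lemma sum_castLE {n k : ℕ} (hk : k ≤ n) (f : Fin n → ℝ) :
    ∑ a : Fin k, f (Fin.castLE hk a) = ∑ i : Fin n, if i.val < k then f i else 0 := by
  obtain ⟨r, rfl⟩ := Nat.exists_eq_add_of_le hk
  rw [Fin.sum_univ_add]
  simp
  rfl

lemma IsSpectral.sum_sq_eq [DecidableEq ι] {n : ℕ} {A : Matrix ι ι ℝ} {σ : Fin n → ℝ}
    {V : Matrix ι (Fin n) ℝ} (h : IsSpectral A σ V) (B : Matrix ι ι ℝ) :
    ∑ x, ∑ x', B x x' ^ 2 = ∑ i, vnorm (B *ᵥ V.col i) ^ 2 := by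
  have h1 : ∀ x, ∑ x', B x x' ^ 2 = ∑ i, (Vᵀ *ᵥ B x) i ^ 2 := fun x => by
    rw [← h.vnorm_sq_eq, vnorm_sq]
    simp only [dotProduct, sq]
  simp only [h1]
  rw [Finset.sum_comm]
  refine Finset.sum_congr rfl fun i _ => ?_
  rw [vnorm_sq]
  simp only [dotProduct, ← sq]
  refine Finset.sum_congr rfl fun x _ => ?_
  congr 1
  exact dotProduct_comm (V.col i) (B x)

variable {Nl Nu : ℕ}

/-- A minimizer of the factorization loss spans the top eigenvectors when there is a gap. -/
lemma exists_mulVec_eq_col_of_minimizer {n k : ℕ}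
    {A : Matrix (Point Nl Nu) (Point Nl Nu) ℝ} {σ : Fin n → ℝ}
    {V : Matrix (Point Nl Nu) (Fin n) ℝ} (h : IsSpectral A σ V) (hσ : ∀ i, 0 ≤ σ i)
    (hk : 0 < k) (hkn : k < n) (hgap : σ ⟨k, hkn⟩ < σ ⟨k - 1, by omega⟩)
    {F : Matrix (Point Nl Nu) (Fin k) ℝ} (hF : ∀ F' : Matrix (Point Nl Nu) (Fin k) ℝ, mfLoss A F ≤ mfLoss A F')
    (i : Fin n) (hi : i.val < k) : ∃ m : Fin k → ℝ, F *ᵥ m = V.col i := by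
  obtain ⟨r, hr, G, hG, ⟨H, hFH⟩, H', hGH⟩ := exists_orthonormal_columns F
  -- `p i` is the share of the `i`-th eigenvector captured by the column space of `F`. Each share is
  -- at most one and their sum at most `k`; the aim is `p i = 1` for the top `k`.
  set p : Fin n → ℝ := fun i => vnorm (Gᵀ *ᵥ V.col i) ^ 2 with hp
  have hcol : ∀ i, vnorm (V.col i) ^ 2 = 1 := fun i => by simp [vnorm_sq, h.dotProduct_col]
  have hp0 : ∀ i, 0 ≤ p i := fun i => sq_nonneg _
  have hproj : ∀ i, vnorm (V.col i - G *ᵥ (Gᵀ *ᵥ V.col i)) ^ 2 = 1 - p i := fun i => by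
    rw [vnorm_sub_mulVec_sq hG, hcol, sub_self]
    simp [vnorm, hp]
  have hp1 : ∀ i, p i ≤ 1 := fun i => by
    have := sq_nonneg (vnorm (V.col i - G *ᵥ (Gᵀ *ᵥ V.col i)))
    rw [hproj] at this
    linarith
  have hpsum : ∑ i, p i ≤ k := by
    have h1 : ∑ i, p i = ∑ j, ∑ i, (Vᵀ *ᵥ G.col j) i ^ 2 := by
      rw [Finset.sum_comm]
      refine Finset.sum_congr rfl fun i _ => ?_
      simp only [hp, vnorm_sq, dotProduct, ← sq]
      refine Finset.sum_congr rfl fun j _ => ?_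
      congr 1
      exact dotProduct_comm (G.col j) (V.col i)
    have h2 : ∀ j, ∑ i, (Vᵀ *ᵥ G.col j) i ^ 2 = 1 := fun j => by
      rw [← h.vnorm_sq_eq, vnorm_sq]
      have := congr_fun (congr_fun hG j) j
      rw [Matrix.one_apply_eq] at this
      exact this
    rw [h1]
    simp only [h2]
    simpa using hr
  have hlower : ∑ i, σ i ^ 2 * (1 - p i) ≤ mfLoss A F := by
    rw [mfLoss, show (∑ x, ∑ x', (A x x' - (F * Fᵀ) x x') ^ 2)
      = ∑ x, ∑ x', (A - F * Fᵀ) x x' ^ 2 from rfl, h.sum_sq_eq]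
    refine Finset.sum_le_sum fun i _ => ?_
    have e : (A - F * Fᵀ) *ᵥ V.col i = σ i • V.col i - G *ᵥ ((H * Fᵀ) *ᵥ V.col i) := by
      rw [Matrix.sub_mulVec, h.mulVec_col, Matrix.mulVec_mulVec, ← Matrix.mul_assoc, ← hFH]
    rw [e, vnorm_sub_mulVec_sq hG]
    have e1 : vnorm (σ i • V.col i) ^ 2 = σ i ^ 2 := by
      rw [vnorm_sq, smul_dotProduct, dotProduct_smul, h.dotProduct_col]
      simp [sq]
    have e2 : vnorm (Gᵀ *ᵥ (σ i • V.col i)) ^ 2 = σ i ^ 2 * p i := by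
      rw [Matrix.mulVec_smul, vnorm_sq, smul_dotProduct, dotProduct_smul, hp]
      simp only [vnorm_sq, smul_eq_mul]
      ring
    rw [e1, e2]
    nlinarith [sq_nonneg (vnorm (Gᵀ *ᵥ (σ i • V.col i) - (H * Fᵀ) *ᵥ V.col i))]
  -- The competitor is the truncated spectral decomposition, whose loss is the sum of the squared
  -- tail eigenvalues.
  let F₀ : Matrix (Point Nl Nu) (Fin k) ℝ :=
    Matrix.of fun x a => V x (Fin.castLE hkn.le a) * Real.sqrt (σ (Fin.castLE hkn.le a))
  have hupper : mfLoss A F₀ = ∑ i, if i.val < k then 0 else σ i ^ 2 := by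
    have hF₀ : F₀ * F₀ᵀ = spectralFun V fun i => if i.val < k then σ i else 0 := by
      ext x x'
      rw [Matrix.mul_apply, spectralFun, Matrix.mul_apply]
      simp only [Matrix.mul_diagonal, Matrix.transpose_apply, F₀, Matrix.of_apply]
      rw [sum_castLE hkn.le (fun i => V x i * Real.sqrt (σ i) * (V x' i * Real.sqrt (σ i)))]
      refine Finset.sum_congr rfl fun i _ => ?_
      split_ifs
      · nth_rewrite 3 [← Real.mul_self_sqrt (hσ i)]
        ring
      · ring
    rw [mfLoss, show (∑ x, ∑ x', (A x x' - (F₀ * F₀ᵀ) x x') ^ 2)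
      = ∑ x, ∑ x', (A - F₀ * F₀ᵀ) x x' ^ 2 from rfl, h.sum_sq_eq]
    refine Finset.sum_congr rfl fun i _ => ?_
    rw [hF₀, h.eq_spectralFun, ← spectralFun_sub, h.vnorm_spectralFun_sq]
    rw [Finset.sum_eq_single i]
    · have : (Vᵀ *ᵥ V.col i) i = 1 := by
        have := h.dotProduct_col i i
        rw [if_pos rfl] at this
        exact this
      rw [this]
      simp only [Pi.sub_apply]
      split_ifs <;> simp
    · intro j _ hj
      have : (Vᵀ *ᵥ V.col i) j = 0 := by
        have := h.dotProduct_col j i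
        rw [if_neg hj] at this
        exact this
      rw [this]
      simp
    · simp
  have hmain := (hlower.trans (hF F₀)).trans hupper.le
  set a := σ ⟨k - 1, by omega⟩
  set b := σ ⟨k, hkn⟩
  have hb0 : 0 ≤ b := hσ _
  have hab : 0 < a ^ 2 - b ^ 2 := by nlinarith
  -- termwise comparison with the two eigenvalues at the gap
  have hterm : ∀ i : Fin n, (if i.val < k then (a ^ 2 - b ^ 2) * (1 - p i) else 0)
      + b ^ 2 * ((if i.val < k then 1 else 0) - p i)
      ≤ σ i ^ 2 * (1 - p i) - if i.val < k then 0 else σ i ^ 2 := fun i => by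
    have h0 := hσ i
    split_ifs with hik
    · have : a ≤ σ i := h.antitone (Fin.le_def.2 (by simp only; omega))
      nlinarith [mul_nonneg (sub_nonneg.2 (hp1 i)) (sub_nonneg.2 (pow_le_pow_left₀
        (hb0.trans hgap.le) this 2))]
    · have : σ i ≤ b := h.antitone (Fin.le_def.2 (by simp only; omega))
      nlinarith [mul_nonneg (hp0 i) (sub_nonneg.2 (pow_le_pow_left₀ h0 this 2))]
  have hsum := Finset.sum_le_sum fun i (_ : i ∈ Finset.univ) => hterm i
  rw [Finset.sum_add_distrib, ← Finset.mul_sum, Finset.sum_sub_distrib,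
    Finset.sum_sub_distrib] at hsum
  have hcount : ∑ i : Fin n, (if i.val < k then (1 : ℝ) else 0) = k := by
    rw [← sum_castLE hkn.le]
    simp
  rw [hcount] at hsum
  -- Here minimality of `F` meets `∑ p i ≤ k`. Since `a > b`, a sum of nonnegative terms that is at
  -- most zero leaves no room for `p i < 1` among the top `k`.
  have hle : ∑ i : Fin n, (if i.val < k then (a ^ 2 - b ^ 2) * (1 - p i) else 0) ≤ 0 := by
    nlinarith [mul_nonneg (sq_nonneg b) (sub_nonneg.2 hpsum)]
  have hnn : ∀ i : Fin n, 0 ≤ if i.val < k then (a ^ 2 - b ^ 2) * (1 - p i) else 0 := fun i => by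
    split_ifs
    · exact mul_nonneg hab.le (sub_nonneg.2 (hp1 i))
    · exact le_rfl
  have hzero := (Finset.sum_eq_zero_iff_of_nonneg fun i _ => hnn i).1
    (le_antisymm hle (Finset.sum_nonneg fun i _ => hnn i)) i (Finset.mem_univ i)
  rw [if_pos hi] at hzero
  have hpi : 1 - p i = 0 := (mul_eq_zero.1 hzero).resolve_left hab.ne'
  have hres := hproj i
  rw [hpi, vnorm_sq] at hres
  refine ⟨H' *ᵥ (Gᵀ *ᵥ V.col i), ?_⟩
  rw [Matrix.mulVec_mulVec, ← hGH]
  exact (sub_eq_zero.1 (dotProduct_self_eq_zero.1 hres)).symm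

end EckartYoung

/-! ### Stability of the tail energy -/

section Perturbation

variable {ι : Type*} [Fintype ι] [DecidableEq ι] {n : ℕ}

namespace IsSpectral

variable {A : Matrix ι ι ℝ} {σ : Fin n → ℝ} {V : Matrix ι (Fin n) ℝ}

lemma proj_proj (h : IsSpectral A σ V) (s : Set (Fin n)) (w : ι → ℝ) :
    spectralFun V (s.indicator 1) *ᵥ (spectralFun V (s.indicator 1) *ᵥ w)
      = spectralFun V (s.indicator 1) *ᵥ w := by
  rw [Matrix.mulVec_mulVec, h.mul_spectralFun]
  congr 1
  refine congrArg _ (funext fun i => ?_)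
  by_cases hi : i ∈ s <;> simp [hi]

lemma proj_compl (h : IsSpectral A σ V) (s : Set (Fin n)) :
    spectralFun V (sᶜ.indicator 1) = 1 - spectralFun V (s.indicator 1) := by
  rw [← h.spectralFun_one, ← spectralFun_sub]
  refine congrArg _ (funext fun i => ?_)
  by_cases hi : i ∈ s <;> simp [hi]

lemma proj_dotProduct_proj (h : IsSpectral A σ V) (s : Set (Fin n)) (w z : ι → ℝ) :
    (spectralFun V (s.indicator 1) *ᵥ w) ⬝ᵥ (spectralFun V (s.indicator 1) *ᵥ z)
      = (spectralFun V (s.indicator 1) *ᵥ w) ⬝ᵥ z := by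
  rw [dotProduct_spectralFun, ← h.dotProduct_transpose, h.transpose_spectralFun]
  refine Finset.sum_congr rfl fun i _ => ?_
  by_cases hi : i ∈ s <;> simp [hi]

end IsSpectral

/-- The energy beyond the top `k` eigenvectors is stable under perturbations small compared with
the eigengap. -/
lemma tail_energy_le {A B : Matrix ι ι ℝ} {σ σ' : Fin n → ℝ} {V V' : Matrix ι (Fin n) ℝ}
    (h : IsSpectral A σ V) (h' : IsSpectral B σ' V') (hσ : ∀ i, 0 ≤ σ i) (hσ' : ∀ i, 0 ≤ σ' i)
    {k : ℕ} (hk : 0 < k) (hkn : k < n)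
    (hδ : specNorm (A - B) < 1 / 2 * (σ ⟨k - 1, by omega⟩ - σ ⟨k, hkn⟩)) (w : ι → ℝ) :
    ∑ i : Fin n, (if k ≤ i.val then (Vᵀ *ᵥ w) i ^ 2 else 0)
      ≤ ∑ i : Fin n, (if k ≤ i.val then (V'ᵀ *ᵥ w) i ^ 2 else 0)
        + 2 * (specNorm (A - B) / (σ ⟨k - 1, by omega⟩ - σ ⟨k, hkn⟩)) * vnorm w ^ 2 := by
  set δ := specNorm (A - B) with hδdef
  have hδ0 : 0 ≤ δ := specNorm_nonneg _
  set a := σ ⟨k - 1, by omega⟩ with ha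
  set b := σ ⟨k, hkn⟩ with hb
  have hb0 : 0 ≤ b := hσ _
  set s : Set (Fin n) := {i | k ≤ i.val}
  set P := spectralFun V (s.indicator 1) with hP
  set Pc := spectralFun V (sᶜ.indicator 1) with hPc
  set Q := spectralFun V' (s.indicator 1) with hQ
  set Qc := spectralFun V' (sᶜ.indicator 1) with hQc
  have hweyl1 : a - δ ≤ σ' ⟨k - 1, by omega⟩ := by
    have := h.eigenvalue_le_add h' ⟨k - 1, by omega⟩
    linarith
  have hweyl2 : σ' ⟨k, hkn⟩ ≤ b + δ := by
    have := h'.eigenvalue_le_add h ⟨k, hkn⟩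
    rw [specNorm_sub_comm] at this
    linarith
  -- By positivity each tail spectrum lies in an interval `[0, y]`, of centre and radius `y / 2`.
  -- Weyl and `hδ` keep the head spectrum of the other matrix at least `(a - b) / 2` above it.
  have habs : ∀ {x y : ℝ}, 0 ≤ x → x ≤ y → |x - y / 2| ≤ y / 2 := fun h0 h1 => by
    rw [abs_le]; constructor <;> linarith
  have hdk1 : specNorm (P * Qc) ≤ 2 * (δ / (a - b)) := by
    refine (h.specNorm_proj_mul_proj_le h' s sᶜ (c := b / 2) (r := b / 2) (γ := (a - b) / 2)
      (by linarith) (by linarith) (fun i hi => habs (hσ i) (h.antitone hi)) fun i hi => ?_).trans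
      (le_of_eq (by rw [← hδdef]; field_simp))
    have : σ' ⟨k - 1, by omega⟩ ≤ σ' i := h'.antitone (Fin.le_def.2 (by
      have : ¬ k ≤ i.val := hi
      simp only; omega))
    linarith
  have hdk2 : specNorm (Q * Pc) ≤ 2 * (δ / (a - b)) := by
    have h0 : 0 ≤ σ' ⟨k, hkn⟩ := hσ' _
    refine (h'.specNorm_proj_mul_proj_le h s sᶜ (c := σ' ⟨k, hkn⟩ / 2) (r := σ' ⟨k, hkn⟩ / 2)
      (γ := (a - b) / 2) (by linarith) (by linarith)
      (fun i hi => habs (hσ' i) (h'.antitone hi)) fun i hi => ?_).trans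
      (le_of_eq (by rw [specNorm_sub_comm, ← hδdef]; field_simp))
    have : a ≤ σ i := h.antitone (Fin.le_def.2 (by
      have : ¬ k ≤ i.val := hi
      simp only; omega))
    linarith
  have hab : 0 < a - b := by linarith
  have hε0 : 0 ≤ 2 * (δ / (a - b)) := mul_nonneg zero_le_two (div_nonneg hδ0 hab.le)
  set ε := 2 * (δ / (a - b))
  -- the projections
  have hsq : ∀ {A : Matrix ι ι ℝ} {σ : Fin n → ℝ} {V : Matrix ι (Fin n) ℝ},
      IsSpectral A σ V → ∑ i : Fin n, (if k ≤ i.val then (Vᵀ *ᵥ w) i ^ 2 else 0)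
        = vnorm (spectralFun V (s.indicator 1) *ᵥ w) ^ 2 := fun hV => by
    rw [hV.vnorm_spectralFun_sq]
    refine Finset.sum_congr rfl fun i _ => ?_
    by_cases hi : k ≤ i.val
    · simp [s, hi]
    · simp [s, hi]
  have hpyth : ∀ {A : Matrix ι ι ℝ} {σ : Fin n → ℝ} {V : Matrix ι (Fin n) ℝ},
      IsSpectral A σ V → vnorm (spectralFun V (s.indicator 1) *ᵥ w) ^ 2
        + vnorm (spectralFun V (sᶜ.indicator 1) *ᵥ w) ^ 2 = vnorm w ^ 2 := fun hV => by
    rw [hV.vnorm_spectralFun_sq, hV.vnorm_spectralFun_sq, hV.vnorm_sq_eq,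
      ← Finset.sum_add_distrib]
    refine Finset.sum_congr rfl fun i _ => ?_
    by_cases hi : i ∈ s
    · simp [hi]
    · simp [hi]
  rw [hsq h, hsq h']
  have e1 : (P *ᵥ w) ⬝ᵥ (Qc *ᵥ w) ≤ ε * (vnorm (P *ᵥ w) * vnorm (Qc *ᵥ w)) := by
    have h1 : (P *ᵥ w) ⬝ᵥ (Qc *ᵥ w) = (P *ᵥ w) ⬝ᵥ ((P * Qc) *ᵥ (Qc *ᵥ w)) := by
      rw [← Matrix.mulVec_mulVec, h'.proj_proj, h.proj_dotProduct_proj]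
    rw [h1]
    exact ((le_abs_self _).trans (abs_dotProduct_mulVec_le _ _ _)).trans
      (mul_le_mul_of_nonneg_right hdk1 (mul_nonneg (vnorm_nonneg _) (vnorm_nonneg _)))
  have e2 : -((Q *ᵥ w) ⬝ᵥ (Pc *ᵥ w)) ≤ ε * (vnorm (Q *ᵥ w) * vnorm (Pc *ᵥ w)) := by
    have h1 : (Q *ᵥ w) ⬝ᵥ (Pc *ᵥ w) = (Q *ᵥ w) ⬝ᵥ ((Q * Pc) *ᵥ (Pc *ᵥ w)) := by
      rw [← Matrix.mulVec_mulVec, h.proj_proj, h'.proj_dotProduct_proj]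
    rw [h1]
    exact ((neg_le_abs _).trans (abs_dotProduct_mulVec_le _ _ _)).trans
      (mul_le_mul_of_nonneg_right hdk2 (mul_nonneg (vnorm_nonneg _) (vnorm_nonneg _)))
  -- The common term `Pw ⬝ Qw` cancels, which leaves products of the tail of one matrix with the
  -- head of the other, both small by Davis–Kahan.
  have e3 : vnorm (P *ᵥ w) ^ 2 - vnorm (Q *ᵥ w) ^ 2
      = (P *ᵥ w) ⬝ᵥ (Qc *ᵥ w) - (Q *ᵥ w) ⬝ᵥ (Pc *ᵥ w) := by
    have c1 : Pc = 1 - P := h.proj_compl s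
    have c2 : Qc = 1 - Q := h'.proj_compl s
    have h1 : (P *ᵥ w) ⬝ᵥ (P *ᵥ w) = (P *ᵥ w) ⬝ᵥ w := h.proj_dotProduct_proj s w w
    have h2 : (Q *ᵥ w) ⬝ᵥ (Q *ᵥ w) = (Q *ᵥ w) ⬝ᵥ w := h'.proj_dotProduct_proj s w w
    rw [c1, c2, Matrix.sub_mulVec, Matrix.sub_mulVec, Matrix.one_mulVec,
      dotProduct_sub, dotProduct_sub, dotProduct_comm (Q *ᵥ w) (P *ᵥ w), vnorm_sq, vnorm_sq,
      h1, h2]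
    ring
  have p1 := hpyth h
  have p2 := hpyth h'
  -- By AM-GM and Pythagoras both products together cost a single `‖w‖²`, so `ε` is not doubled.
  have e4 : vnorm (P *ᵥ w) * vnorm (Qc *ᵥ w) + vnorm (Q *ᵥ w) * vnorm (Pc *ᵥ w)
      ≤ vnorm w ^ 2 := by
    nlinarith [sq_nonneg (vnorm (P *ᵥ w) - vnorm (Qc *ᵥ w)),
      sq_nonneg (vnorm (Q *ᵥ w) - vnorm (Pc *ᵥ w))]
  nlinarith [mul_le_mul_of_nonneg_left e4 hε0]

end Perturbation

/-! ### The linear probing error -/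

section ErrorBound

variable {Nl Nu : ℕ}

lemma sum_rest {n : ℕ} (k : ℕ) (f : Fin n → ℝ) :
    ∑ i : Rest n k, f i.val = ∑ i, if k ≤ i.val then f i else 0 := by
  rw [← Finset.sum_filter]
  exact (Finset.sum_subtype _ (by simp) f).symm

/-- At a misclassified point the picked score `b` is at least the score `a` of the true class, so `2
((1 - a)² + b²) = (1 - a + b)² + (1 - a - b)² ≥ 1`. The weights `w` preserve this order; they absorb
the factor `√w_x` between `f` and its embedding. -/
lemma probingError_le {k : ℕ} {Y : Type*} [Fintype Y] [DecidableEq Y] {pick : (Y → ℝ) → Y}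
    (hpick : ∀ (v : Y → ℝ) (c : Y), v c ≤ v (pick v)) (label : Fin Nu → Y)
    (f : Point Nl Nu → Fin k → ℝ) {w : Fin Nu → ℝ} (hw : ∀ x, 0 ≤ w x)
    (M : Matrix (Fin k) Y ℝ) :
    (probingError pick label f : ℝ) ≤
      2 * ∑ c, ∑ x, (labelVec label c x - w x * (f (Sum.inr x) ᵥ* M) c) ^ 2 := by
  have h1 : probingError pick label f ≤
      (Finset.univ.filter fun x : Fin Nu => label x ≠ pick (f (Sum.inr x) ᵥ* M)).card :=
    ciInf_le (OrderBot.bddBelow _) M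
  have h2 : ((Finset.univ.filter
      fun x : Fin Nu => label x ≠ pick (f (Sum.inr x) ᵥ* M)).card : ℝ)
      = ∑ x : Fin Nu, if label x ≠ pick (f (Sum.inr x) ᵥ* M) then (1 : ℝ) else 0 := by
    rw [Finset.sum_boole]
  refine (Nat.cast_le.2 h1).trans ?_
  rw [h2, Finset.sum_comm, Finset.mul_sum]
  refine Finset.sum_le_sum fun x _ => ?_
  split_ifs with hx
  · set v := f (Sum.inr x) ᵥ* M
    have h3 : w x * v (label x) ≤ w x * v (pick v) :=
      mul_le_mul_of_nonneg_left (hpick v _) (hw x)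
    have h4 : ∑ c ∈ {label x, pick v}, (labelVec label c x - w x * v c) ^ 2
        ≤ ∑ c, (labelVec label c x - w x * v c) ^ 2 :=
      Finset.sum_le_sum_of_subset_of_nonneg (Finset.subset_univ _) fun _ _ _ => sq_nonneg _
    rw [Finset.sum_pair hx] at h4
    rw [show labelVec label (label x) x = 1 from if_pos rfl,
      show labelVec label (pick v) x = 0 from if_neg hx] at h4
    nlinarith [sq_nonneg (1 - w x * v (label x) - w x * v (pick v)),
      sq_nonneg (w x * v (pick v) - w x * v (label x))]
  · exact mul_nonneg zero_le_two (Finset.sum_nonneg fun _ _ => sq_nonneg _)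

variable {A : Matrix (Point Nl Nu) (Point Nl Nu) ℝ} {n : ℕ} {σ : Fin n → ℝ}
  {V : Matrix (Point Nl Nu) (Fin n) ℝ}

lemma averaged_eigen_inl (hA : Aᵀ = A) (h : IsSpectral (averaged A) σ V) (i : Fin n)
    (p : Fin Nl) : σ i * V (Sum.inl p) i
      = etaU A ⬝ᵥ unlabeledPart (V.col i) + etaL A * labeledSum (V.col i) := by
  rw [← averaged_mulVec_inl hA _ p, h.mulVec_col]
  rfl

lemma averaged_eigen_inr (h : IsSpectral (averaged A) σ V) (i : Fin n) :
    σ i • unlabeledPart (V.col i) = unlabeledBlock A *ᵥ unlabeledPart (V.col i)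
      + labeledSum (V.col i) • etaU A := by
  funext p
  have := averaged_mulVec_inr (A := A) (V.col i) p
  rw [h.mulVec_col] at this
  exact this

/-- An eigenvector of a nonzero eigenvalue is constant on the labeled points. -/
lemma labeledSum_sq (hNl : 0 < Nl) (hA : Aᵀ = A) (h : IsSpectral (averaged A) σ V) {i : Fin n}
    (hi : σ i ≠ 0) :
    labeledSum (V.col i) ^ 2 = Nl * (1 - ∑ x : Fin Nu, V (Sum.inr x) i ^ 2) := by
  have hN : (Nl : ℝ) ≠ 0 := by exact_mod_cast hNl.ne'
  obtain ⟨t, ht⟩ : ∃ t, ∀ p : Fin Nl, V (Sum.inl p) i = t :=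
    ⟨_, fun p => (eq_div_iff hi).2 ((mul_comm _ _).trans (averaged_eigen_inl hA h i p))⟩
  have h1 : vnorm (V.col i) ^ 2 = 1 := by simp [vnorm_sq, h.dotProduct_col]
  rw [vnorm_sq_sum, vnorm_sq] at h1
  have h2 : unlabeledPart (V.col i) ⬝ᵥ unlabeledPart (V.col i)
      = ∑ x : Fin Nu, V (Sum.inr x) i ^ 2 := by
    simp only [dotProduct, ← sq]; rfl
  have h3 : ∑ p : Fin Nl, V.col i (Sum.inl p) ^ 2 = Nl * t ^ 2 := by simp [ht]
  have h4 : labeledSum (V.col i) = Nl * t := by simp [labeledSum, ht]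
  rw [← h2, ← h1, h3, h4]
  ring

/-- Indices in the support contribute exactly, by `labeledSum_sq`; the squares at null eigenvectors
are dropped. -/
lemma mul_labeledMass_le (hNl : 0 < Nl) (hA : Aᵀ = A) (h : IsSpectral (averaged A) σ V) (k : ℕ) :
    Nl * (((restSupport k σ).card : ℝ) * labeledMass k σ V) ≤ vnorm (knowledge k V) ^ 2 := by
  have h1 : ((restSupport k σ).card : ℝ) * labeledMass k σ V
      = ∑ i ∈ restSupport k σ, (1 - ∑ x : Fin Nu, V (Sum.inr x) i ^ 2) := by
    rw [labeledMass]
    rcases (restSupport k σ).eq_empty_or_nonempty with he | hne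
    · simp [he]
    · have : ((restSupport k σ).card : ℝ) ≠ 0 := by exact_mod_cast hne.card_pos.ne'
      field_simp
  have h2 : vnorm (knowledge k V) ^ 2
      = ∑ i : Fin n, if k ≤ i.val then labeledSum (V.col i) ^ 2 else 0 := by
    rw [← sum_rest, vnorm_sq]
    simp only [dotProduct, ← sq]
    rfl
  rw [h1, h2, Finset.mul_sum, ← Finset.sum_filter]
  calc _ = ∑ i ∈ restSupport k σ, labeledSum (V.col i) ^ 2 :=
        Finset.sum_congr rfl fun i hi =>
          (labeledSum_sq hNl hA h (by simp [restSupport] at hi; exact hi.2)).symm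
    _ ≤ _ := Finset.sum_le_sum_of_subset_of_nonneg (fun i hi => by
        simp only [restSupport, Finset.mem_filter] at hi ⊢; exact ⟨hi.1, hi.2.1⟩)
        fun _ _ _ => sq_nonneg _

/-- Each summand of the mass is a square divided by `Nl`. The support is nonempty, since division by
zero would make the mean vanish. -/
lemma card_mul_labeledMass_pos (hNl : 0 < Nl) (hA : Aᵀ = A) (h : IsSpectral (averaged A) σ V)
    {k : ℕ} (hm : labeledMass k σ V ≠ 0) :
    0 < ((restSupport k σ).card : ℝ) * labeledMass k σ V := by
  have hNl' : (0 : ℝ) < Nl := by exact_mod_cast hNl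
  refine lt_of_le_of_ne ?_ (Ne.symm (mul_ne_zero (fun h0 => hm ?_) hm))
  · refine mul_nonneg (Nat.cast_nonneg _) (div_nonneg (Finset.sum_nonneg fun i hi => ?_)
      (Nat.cast_nonneg _))
    have := labeledSum_sq hNl hA h (i := i) (by simp [restSupport] at hi; exact hi.2)
    exact nonneg_of_mul_nonneg_right (this ▸ sq_nonneg _) hNl'
  · rw [labeledMass, h0, div_zero]

/-- The convention `x / 0 = 0` makes this hold for zero vectors too. -/
lemma cosine_sq_mul {ι : Type*} [Fintype ι] (v w : ι → ℝ) :
    cosine v w ^ 2 * vnorm v ^ 2 = (v ⬝ᵥ w) ^ 2 / vnorm w ^ 2 := by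
  rw [cosine, div_pow, mul_pow]
  rcases eq_or_ne (vnorm v) 0 with hv | hv
  · have : v ⬝ᵥ w = 0 := by
      have := abs_dotProduct_le v w
      rw [hv, zero_mul] at this
      exact abs_nonpos_iff.1 this
    simp [this, hv]
  · rcases eq_or_ne (vnorm w) 0 with hw | hw
    · simp [hw]
    · field_simp

/-- The best constant extension of a labeling vector to the labeled points. -/
lemma exists_extension (k : ℕ) (V : Matrix (Point Nl Nu) (Fin n) ℝ) (y : Fin Nu → ℝ)
    (hV : 0 < vnorm (knowledge k V)) :
    ∃ t : ℝ, (∑ i : Fin n, if k ≤ i.val then (Vᵀ *ᵥ Sum.elim (fun _ => t) y) i ^ 2 else 0)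
        = vnorm (ignorance k V y) ^ 2 * (1 - coverage k V y ^ 2) ∧
      t ^ 2 * vnorm (knowledge k V) ^ 2
        = coverage k V y ^ 2 * vnorm (ignorance k V y) ^ 2 := by
  set a := ignorance k V y with ha
  set b := knowledge k V with hb
  have hc : coverage k V y ^ 2 * vnorm a ^ 2 = (a ⬝ᵥ b) ^ 2 / vnorm b ^ 2 := cosine_sq_mul a b
  -- The minimizer of `‖a + t b‖²`.
  refine ⟨-(a ⬝ᵥ b) / vnorm b ^ 2, ?_, ?_⟩
  · set t := -(a ⬝ᵥ b) / vnorm b ^ 2 with ht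
    have h1 : ∀ i : Rest n k, (Vᵀ *ᵥ Sum.elim (fun _ => t) y) i.val = a i + t * b i := fun i => by
      simp only [Matrix.mulVec, dotProduct, Fintype.sum_sum_type, Matrix.transpose_apply,
        Sum.elim_inl, Sum.elim_inr, ha, hb, ignorance, knowledge, Finset.mul_sum]
      rw [add_comm]
      congr 1
      exact Finset.sum_congr rfl fun _ _ => mul_comm _ _
    rw [← sum_rest k (fun i => (Vᵀ *ᵥ Sum.elim (fun _ => t) y) i ^ 2)]
    simp only [h1]
    have h2 : ∑ i, (a i + t * b i) ^ 2 = vnorm a ^ 2 + 2 * t * (a ⬝ᵥ b) + t ^ 2 * vnorm b ^ 2 := by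
      simp only [vnorm_sq, dotProduct, Finset.mul_sum, ← Finset.sum_add_distrib]
      exact Finset.sum_congr rfl fun _ _ => by ring
    rw [h2, mul_sub, mul_one, mul_comm (vnorm a ^ 2), hc, ht]
    field_simp
    ring
  · rw [hc]
    field_simp

lemma vnorm_ignorance_le {A : Matrix (Point Nl Nu) (Point Nl Nu) ℝ} (h : IsSpectral A σ V)
    (k : ℕ) (y : Fin Nu → ℝ) : vnorm (ignorance k V y) ≤ vnorm y := by
  refine le_of_sq_le_sq ?_ (vnorm_nonneg y)
  have h1 : vnorm y ^ 2 = vnorm (Sum.elim (fun _ : Fin Nl => (0 : ℝ)) y) ^ 2 := by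
    rw [vnorm_sq_sum]
    simp only [Sum.elim_inl]
    simp
    rfl
  rw [h1, h.vnorm_sq_eq, vnorm_sq]
  have h2 : ∀ i : Rest n k, ignorance k V y i
      = (Vᵀ *ᵥ Sum.elim (fun _ : Fin Nl => (0 : ℝ)) y) i.val := fun i => by
    simp [Matrix.mulVec, dotProduct, ignorance]
  simp only [dotProduct, h2, ← sq]
  rw [sum_rest k (fun i => (Vᵀ *ᵥ Sum.elim (fun _ : Fin Nl => (0 : ℝ)) y) i ^ 2)]
  refine Finset.sum_le_sum fun i _ => ?_
  split_ifs
  · exact le_rfl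
  · exact sq_nonneg _

/-- Regression of a labeling vector on the learned features. -/
lemma exists_head_residual_le (hNl : 0 < Nl) (hA : Aᵀ = A) (hpos : ∀ x, 0 ≤ x ⬝ᵥ (A *ᵥ x))
    (h : IsSpectral A σ V) {σ' : Fin n → ℝ} {V' : Matrix (Point Nl Nu) (Fin n) ℝ}
    (h' : IsSpectral (averaged A) σ' V') {k : ℕ} (hk : 0 < k) (hkn : k < n)
    (hδ : specNorm (A - averaged A) < 1 / 2 * (σ ⟨k - 1, by omega⟩ - σ ⟨k, hkn⟩))
    (hm : labeledMass k σ' V' ≠ 0) {F : Matrix (Point Nl Nu) (Fin k) ℝ}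
    (hF : ∀ F' : Matrix (Point Nl Nu) (Fin k) ℝ, mfLoss A F ≤ mfLoss A F') (y : Fin Nu → ℝ)
    (hy : 0 < vnorm y) :
    ∃ m : Fin k → ℝ, ∑ x : Fin Nu, (y x - (F *ᵥ m) (Sum.inr x)) ^ 2 ≤
      vnorm y ^ 2 * (ignoranceDegree k V' y * (1 - coverage k V' y ^ 2) +
        2 * (1 + coverage k V' y ^ 2 * ignoranceDegree k V' y ^ 2 /
            (((restSupport k σ').card : ℝ) * labeledMass k σ' V')) *
          (specNorm (A - averaged A) / (σ ⟨k - 1, by omega⟩ - σ ⟨k, hkn⟩))) := by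
  have hNl' : (0 : ℝ) < Nl := by exact_mod_cast hNl
  have hδ0 := specNorm_nonneg (A - averaged A)
  have hσ := h.eigenvalue_nonneg hpos
  have hσ' := h'.eigenvalue_nonneg (averaged_quadForm_nonneg hNl hA hpos)
  have hμ := card_mul_labeledMass_pos hNl hA h' hm
  have hkl := mul_labeledMass_le hNl hA h' k
  have htail := tail_energy_le h h' hσ hσ' hk hkn hδ
  set gap := σ ⟨k - 1, by omega⟩ - σ ⟨k, hkn⟩ with hgap
  have hgap0 : 0 < gap := by linarith
  set μ := ((restSupport k σ').card : ℝ) * labeledMass k σ' V'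
  have hK : 0 < vnorm (knowledge k V') :=
    lt_of_le_of_ne (vnorm_nonneg _) fun h0 => by
      rw [← h0] at hkl
      nlinarith [mul_pos hNl' hμ]
  obtain ⟨t, ht1, ht2⟩ := exists_extension k V' y hK
  set w : Point Nl Nu → ℝ := Sum.elim (fun _ => t) y with hw
  have hcols := exists_mulVec_eq_col_of_minimizer h hσ hk hkn (by linarith) hF
  choose m hm' using hcols
  -- The head reproduces the projection of `w` to the top `k` eigenvectors, so the residual is
  -- exactly the tail energy.
  have hbound : ∃ m₀ : Fin k → ℝ, vnorm (w - F *ᵥ m₀) ^ 2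
      = ∑ i : Fin n, if k ≤ i.val then (Vᵀ *ᵥ w) i ^ 2 else 0 := by
    refine ⟨∑ i : Fin n, if hi : i.val < k then (Vᵀ *ᵥ w) i • m i hi else 0, ?_⟩
    have e1 : F *ᵥ (∑ i : Fin n, if hi : i.val < k then (Vᵀ *ᵥ w) i • m i hi else 0)
        = V *ᵥ fun i => if i.val < k then (Vᵀ *ᵥ w) i else 0 := by
      rw [Matrix.mulVec_sum]
      have e2 : ∀ i : Fin n, F *ᵥ (if hi : i.val < k then (Vᵀ *ᵥ w) i • m i hi else 0)
          = (if i.val < k then (Vᵀ *ᵥ w) i else 0) • V.col i := fun i => by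
        split_ifs with hi
        · rw [Matrix.mulVec_smul, hm']
        · simp
      simp only [e2]
      funext x
      rw [Finset.sum_apply]
      exact Finset.sum_congr rfl fun i _ => mul_comm _ _
    rw [e1, h.vnorm_sq_eq, Matrix.mulVec_sub, h.transpose_mulVec_mulVec]
    refine Finset.sum_congr rfl fun i _ => ?_
    simp only [Pi.sub_apply]
    by_cases hi : k ≤ i.val
    · simp [hi, not_lt.2 hi]
    · simp [hi, not_le.1 hi]
  obtain ⟨m₀, hm₀⟩ := hbound
  refine ⟨m₀, ?_⟩
  have hpart : ∑ x : Fin Nu, (y x - (F *ᵥ m₀) (Sum.inr x)) ^ 2 ≤ vnorm (w - F *ᵥ m₀) ^ 2 := by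
    rw [vnorm_sq_sum, vnorm_sq]
    have : unlabeledPart (w - F *ᵥ m₀) ⬝ᵥ unlabeledPart (w - F *ᵥ m₀)
        = ∑ x : Fin Nu, (y x - (F *ᵥ m₀) (Sum.inr x)) ^ 2 := by
      simp only [dotProduct, ← sq]; rfl
    rw [this]
    linarith [Finset.sum_nonneg fun (p : Fin Nl) (_ : p ∈ Finset.univ) =>
      sq_nonneg ((w - F *ᵥ m₀) (Sum.inl p))]
  refine hpart.trans (hm₀.le.trans ((htail w).trans ?_))
  rw [ht1]
  have hwn : vnorm w ^ 2 = Nl * t ^ 2 + vnorm y ^ 2 := by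
    rw [vnorm_sq_sum]
    simp [hw]
    rfl
  set I := vnorm (ignorance k V' y) with hI
  set κ := coverage k V' y
  set D := specNorm (A - averaged A) / gap with hD
  have hD0 : 0 ≤ D := div_nonneg hδ0 hgap0.le
  have hI0 : 0 ≤ I := vnorm_nonneg _
  have hIy : I ≤ vnorm y := vnorm_ignorance_le h' k y
  have hT : ignoranceDegree k V' y = I / vnorm y := rfl
  have hκ1 : κ ^ 2 ≤ 1 := by
    have := abs_dotProduct_le (ignorance k V' y) (knowledge k V')
    rw [sq_le_one_iff_abs_le_one]
    change |_ / _| ≤ _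
    rw [abs_div, abs_of_nonneg (mul_nonneg (vnorm_nonneg (ignorance k V' y)) hK.le)]
    exact div_le_one_of_le₀ this (mul_nonneg (vnorm_nonneg _) hK.le)
  -- As `I ≤ ‖y‖`, the square of the ignorance degree is relaxed to its first power.
  have h1 : I ^ 2 * (1 - κ ^ 2) ≤ vnorm y ^ 2 * (I / vnorm y * (1 - κ ^ 2)) := by
    rw [← mul_assoc]
    refine mul_le_mul_of_nonneg_right ?_ (sub_nonneg.2 hκ1)
    rw [show vnorm y ^ 2 * (I / vnorm y) = vnorm y * I by field_simp]
    nlinarith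
  have h2 : Nl * t ^ 2 ≤ κ ^ 2 * I ^ 2 / μ := by
    rw [le_div_iff₀ hμ, ← ht2]
    nlinarith [mul_le_mul_of_nonneg_left hkl (sq_nonneg t)]
  have h3 : vnorm y ^ 2 * (κ ^ 2 * (I / vnorm y) ^ 2 / μ) = κ ^ 2 * I ^ 2 / μ := by
    field_simp
  rw [hT, hwn]
  have h4 : 2 * D * (Nl * t ^ 2 + vnorm y ^ 2) ≤
      vnorm y ^ 2 * (2 * (1 + κ ^ 2 * (I / vnorm y) ^ 2 / μ) * D) := by
    rw [show vnorm y ^ 2 * (2 * (1 + κ ^ 2 * (I / vnorm y) ^ 2 / μ) * D)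
      = 2 * D * (vnorm y ^ 2 * (κ ^ 2 * (I / vnorm y) ^ 2 / μ) + vnorm y ^ 2) by ring, h3]
    exact mul_le_mul_of_nonneg_left (by linarith) (by linarith)
  rw [mul_add]
  linarith

/-- The linear probing error of a learned representation. -/
theorem probingError_le_sum {Known S : Type*} [Fintype Known] [MeasurableSpace S]
    (hNl : 0 < Nl) (hNu : 0 < Nu) (G : AugData Nl Nu Known S)
    (h : IsSpectral G.normAdj σ V) {σ' : Fin n → ℝ} {V' : Matrix (Point Nl Nu) (Fin n) ℝ}
    (h' : IsSpectral (averaged G.normAdj) σ' V') {k : ℕ} (hk : 0 < k) (hkn : k < n)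
    (hδ : specNorm (G.normAdj - averaged G.normAdj)
      < 1 / 2 * (σ ⟨k - 1, by omega⟩ - σ ⟨k, hkn⟩))
    (hm : labeledMass k σ' V' ≠ 0) {f : Point Nl Nu → Fin k → ℝ} (hf : G.IsLearned f)
    {Y : Type*} [Fintype Y] [DecidableEq Y] (label : Fin Nu → Y)
    (hlabel : ∀ c, (Finset.univ.filter fun x => label x = c).card * Fintype.card Y = Nu)
    {pick : (Y → ℝ) → Y} (hpick : ∀ (v : Y → ℝ) (c : Y), v c ≤ v (pick v)) :
    (probingError pick label f : ℝ) ≤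
      2 * (Nu : ℝ) / (Fintype.card Y : ℝ) *
        ∑ c : Y, (ignoranceDegree k V' (labelVec label c) *
            (1 - coverage k V' (labelVec label c) ^ 2) +
          2 * (1 + coverage k V' (labelVec label c) ^ 2 *
                ignoranceDegree k V' (labelVec label c) ^ 2 /
                (((restSupport k σ').card : ℝ) * labeledMass k σ' V')) *
            (specNorm (G.normAdj - averaged G.normAdj) /
              (σ ⟨k - 1, by omega⟩ - σ ⟨k, hkn⟩))) := by
  have hNu' : (0 : ℝ) < Nu := by exact_mod_cast hNu
  have hY : (0 : ℝ) < Fintype.card Y := by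
    have : Nonempty Y := ⟨label ⟨0, hNu⟩⟩
    exact_mod_cast Fintype.card_pos
  have hy : ∀ c, vnorm (labelVec label c) ^ 2 = Nu / Fintype.card Y := fun c => by
    have h1 : ((Finset.univ.filter fun x => label x = c).card : ℝ) * Fintype.card Y = Nu := by
      exact_mod_cast hlabel c
    rw [eq_div_iff hY.ne', ← h1, vnorm_sq, Finset.card_filter]
    congr 1
    push_cast
    exact Finset.sum_congr rfl fun x _ => by simp only [labelVec]; split_ifs <;> simp
  have hy0 : ∀ c, 0 < vnorm (labelVec label c) := fun c => by
    refine lt_of_le_of_ne (vnorm_nonneg _) fun h0 => ?_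
    have h1 := hy c
    rw [← h0, zero_pow two_ne_zero] at h1
    exact (div_pos hNu' hY).ne h1
  choose m hm' using fun c => exists_head_residual_le hNl G.normAdj_transpose
    G.normAdj_quadForm_nonneg h h' hk hkn hδ hm hf (labelVec label c) (hy0 c)
  refine (probingError_le hpick label f (w := fun x => Real.sqrt (G.degree (Sum.inr x)))
    (fun _ => Real.sqrt_nonneg _) (Matrix.of fun a c => m c a)).trans ?_
  rw [show 2 * (Nu : ℝ) / (Fintype.card Y : ℝ) = 2 * (Nu / Fintype.card Y) by ring, mul_assoc,
    Finset.mul_sum (a := (Nu : ℝ) / _)]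
  refine mul_le_mul_of_nonneg_left (Finset.sum_le_sum fun c _ => ?_) zero_le_two
  rw [← hy c]
  refine le_trans (le_of_eq (Finset.sum_congr rfl fun x _ => ?_)) (hm' c)
  congr 2
  simp only [Matrix.vecMul, Matrix.mulVec, dotProduct, AugData.embed, Matrix.of_apply,
    Finset.mul_sum, mul_assoc]

end ErrorBound

/-! ### The Kantorovich inequality -/

section Kantorovich

/-- Comparison of the Kantorovich ratio of two numbers with that of approximants. -/
lemma kantorovich_ratio_le {r r' x x' L H t : ℝ} (hr : 0 < r) (hr' : 0 < r') (hx : 0 < x)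
    (hxx : x ≤ x') (ht0 : 0 ≤ t) (ht1 : t ≤ 1) (htL : t * H ≤ L) (hL : L * r ≤ x)
    (hH : x' ≤ H * r') :
    Real.sqrt t * (2 * Real.sqrt (r * r') / (r + r')) ≤ 2 * Real.sqrt (x * x') / (x + x') := by
  have hx' : 0 < x' := hx.trans_le hxx
  have h1 : t * r * x' ≤ r' * x := by
    have e1 := mul_le_mul_of_nonneg_left hH (mul_nonneg ht0 hr.le)
    have e2 := mul_le_mul_of_nonneg_left hL hr'.le
    have e3 := mul_le_mul_of_nonneg_right htL (mul_nonneg hr.le hr'.le)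
    nlinarith
  have h2 : t * r * x ≤ r' * x' := by
    have e1 := mul_le_mul_of_nonneg_left hxx (mul_nonneg ht0 hr.le)
    have e2 := mul_le_mul_of_nonneg_left hxx hr'.le
    linarith
  -- Expand `(r' x - t r x') (r' x' - t r x) ≥ 0`; the remaining terms have slack because `t ≤ 1`.
  -- Only a lower bound on the smaller number and an upper bound on the larger one enter.
  have h3 : t * (r * r') * (x + x') ^ 2 ≤ x * x' * (r + r') ^ 2 := by
    have e1 := mul_nonneg (sub_nonneg.2 h1) (sub_nonneg.2 h2)
    have e2 : 0 ≤ x * x' * r ^ 2 * (1 - t ^ 2) := by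
      have : t ^ 2 ≤ 1 := pow_le_one₀ ht0 ht1
      have := sub_nonneg.2 this
      positivity
    have e3 : 0 ≤ 2 * (x * x') * (r * r') * (1 - t) := by
      have := sub_nonneg.2 ht1
      positivity
    nlinarith
  rw [mul_div_assoc', div_le_div_iff₀ (by positivity) (by positivity)]
  have h4 : Real.sqrt (t * (r * r') * (x + x') ^ 2) ≤ Real.sqrt (x * x' * (r + r') ^ 2) :=
    Real.sqrt_le_sqrt h3
  rw [Real.sqrt_mul (by positivity), Real.sqrt_mul (by positivity),
    Real.sqrt_mul (by positivity) ((r + r') ^ 2), Real.sqrt_sq (by positivity),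
    Real.sqrt_sq (by positivity)] at h4
  linarith

/-- The Kantorovich inequality, as a bound on the angle between `w` and its multiple by positive
factors. -/
lemma le_cosine_of_forall_ratio {ι : Type*} [Fintype ι] {v w x : ι → ℝ} {s : Finset ι}
    (hs : s.Nonempty) (hout : ∀ i, i ∉ s → w i = 0) (hw : ∀ i ∈ s, w i ≠ 0)
    (hv : ∀ i, v i = w i * x i) (hx : ∀ i ∈ s, 0 < x i) {c : ℝ}
    (hc : ∀ i ∈ s, ∀ j ∈ s, x i ≤ x j → c ≤ 2 * Real.sqrt (x i * x j) / (x i + x j)) :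
    c ≤ cosine v w := by
  obtain ⟨i, hi, hmin⟩ := s.exists_min_image x hs
  obtain ⟨j, hj, hmax⟩ := s.exists_max_image x hs
  refine (hc i hi j hj (hmin j hj)).trans ?_
  set a := x i
  set b := x j
  have ha : 0 < a := hx i hi
  have hb : 0 < b := hx j hj
  -- This is `(x l - a) (b - x l) ≥ 0` weighted by `w l ^ 2`. After summation, AM-GM on `‖v‖² + a b
  -- ‖w‖²` produces the cosine.
  have hterm : ∀ l, 0 ≤ (a + b) * (v l * w l) - v l * v l - a * b * (w l * w l) := fun l => by
    by_cases hl : l ∈ s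
    · have h1 := mul_nonneg (sub_nonneg.2 (hmin l hl)) (sub_nonneg.2 (hmax l hl))
      rw [hv l]
      have := mul_nonneg (mul_self_nonneg (w l)) h1
      nlinarith
    · rw [hv l, hout l hl]; simp
  have hsum : vnorm v ^ 2 + a * b * vnorm w ^ 2 ≤ (a + b) * (v ⬝ᵥ w) := by
    have h1 := Finset.sum_nonneg fun l (_ : l ∈ Finset.univ) => hterm l
    rw [Finset.sum_sub_distrib, Finset.sum_sub_distrib, ← Finset.mul_sum, ← Finset.mul_sum] at h1
    rw [vnorm_sq, vnorm_sq]
    simp only [dotProduct]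
    linarith
  have hpos : ∀ z : ι → ℝ, z i ≠ 0 → 0 < vnorm z := fun z hz =>
    lt_of_le_of_ne (vnorm_nonneg z) fun h0 => hz (by
      have h1 := vnorm_sq z
      rw [← h0, zero_pow two_ne_zero] at h1
      exact congr_fun (dotProduct_self_eq_zero.1 h1.symm) i)
  have hvp : 0 < vnorm v := hpos v (by rw [hv]; exact mul_ne_zero (hw i hi) ha.ne')
  have hwp : 0 < vnorm w := hpos w (hw i hi)
  rw [cosine, div_le_div_iff₀ (by positivity) (by positivity)]
  have hq : Real.sqrt (a * b) ^ 2 = a * b := Real.sq_sqrt (by positivity)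
  nlinarith [sq_nonneg (vnorm v - Real.sqrt (a * b) * vnorm w)]

end Kantorovich

/-! ### The secular equation -/

section Secular

variable {ι : Type*} [Fintype ι] {d e u : ι → ℝ} {s S N l g : ℝ} {j₀ : ι}

/-- If `S = 0`, the first equation kills `u` away from `j₀` and the second kills `u j₀`. With `S ≠
0`, the equation at `j₀` excludes `s = d j₀`. So no denominator of the resolvent takes its default
value. -/
lemma secular_ne_zero [DecidableEq ι] (hN : N ≠ 0) (hg : 0 < g) (h1 : ∀ j, s * u j = d j * u j + S * e j)
    (h2 : s * S = N * (∑ j, e j * u j + l * S)) (h3 : ∀ j, j ≠ j₀ → g / 2 ≤ |s - d j|)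
    (h4 : e j₀ ≠ 0) (h5 : S = 0 → u ≠ 0) : S ≠ 0 ∧ ∀ j, s - d j ≠ 0 := by
  have hne : ∀ j, j ≠ j₀ → s - d j ≠ 0 := fun j hj h0 => by
    have := h3 j hj
    rw [h0, abs_zero] at this
    linarith
  have hS : S ≠ 0 := fun hS => by
    refine h5 hS (funext fun j => ?_)
    have hu : ∀ j, j ≠ j₀ → u j = 0 := fun j hj => by
      have := h1 j
      rw [hS] at this
      exact (mul_eq_zero.1 (show (s - d j) * u j = 0 by linarith)).resolve_left (hne j hj)
    by_cases hj : j = j₀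
    · rw [hS, Finset.sum_eq_single j₀ (fun b _ hb => by rw [hu b hb, mul_zero])
        (by simp)] at h2
      subst hj
      have : e j * u j = 0 := by
        have : N * (e j * u j) = 0 := by linarith
        exact (mul_eq_zero.1 this).resolve_left hN
      exact (mul_eq_zero.1 this).resolve_left h4
    · exact hu j hj
  refine ⟨hS, fun j => ?_⟩
  by_cases hj : j = j₀
  · subst hj
    intro h0
    have := h1 j
    rw [show d j = s by linarith] at this
    exact mul_ne_zero hS h4 (by linarith)
  · exact hne j hj

/-- Solving gives `u j = S * e j / (s - d j)`. Pairing with the labeling vector yields the resolvent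
value, pairing with `e` itself the secular equation. -/
lemma secular_pairing (h1 : ∀ j, s * u j = d j * u j + S * e j) (hs : ∀ j, s - d j ≠ 0)
    (y : ι → ℝ) : ∑ j, y j * u j = S * ∑ j, y j * e j / (s - d j) := by
  rw [Finset.mul_sum]
  refine Finset.sum_congr rfl fun j _ => ?_
  have := hs j
  field_simp
  linear_combination y j * h1 j

lemma abs_sum_erase_le [DecidableEq ι] (hg : 0 < g) (h3 : ∀ j, j ≠ j₀ → g / 2 ≤ |s - d j|) (a : ι → ℝ) :
    |∑ j ∈ Finset.univ.erase j₀, a j / (s - d j)| ≤ 2 / g * ∑ j, |a j| := by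
  refine (Finset.abs_sum_le_sum_abs _ _).trans ?_
  rw [Finset.mul_sum]
  refine (Finset.sum_le_sum fun j hj => ?_).trans
    (Finset.sum_le_sum_of_subset_of_nonneg (Finset.erase_subset _ _) fun _ _ _ => by positivity)
  have h := h3 j (Finset.ne_of_mem_erase hj)
  rw [abs_div, div_le_iff₀ (by linarith)]
  have := mul_le_mul_of_nonneg_left h (show 0 ≤ 2 / g * |a j| by positivity)
  refine le_trans (le_of_eq ?_) this
  field_simp

/-- Size and sign of the resolvent value at a solution of the secular equation near `d j₀`. -/
lemma secular_resolvent_bounds [DecidableEq ι] {y : ι → ℝ} {τ ε₁ ε₂ : ℝ} (hN : 0 < N) (hg : 0 < g) (hl : 0 < l)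
    (h1 : ∀ j, s * u j = d j * u j + S * e j) (h2 : s * S = N * (∑ j, e j * u j + l * S))
    (h3 : ∀ j, j ≠ j₀ → g / 2 ≤ |s - d j|) (h4 : e j₀ ≠ 0) (hS : S ≠ 0)
    (hs : ∀ j, s - d j ≠ 0) (hs0 : 0 ≤ s) (hsτ : s ≤ τ * (N * l)) (hτ0 : 0 ≤ τ) (hτ : τ < 1)
    (hy : y j₀ ≠ 0) (hε₁ : ε₁ < 1) (hε₂0 : 0 ≤ ε₂) (hε₂ : ε₂ < 1)
    (he : N * (2 / g * ∑ j, e j ^ 2) ≤ ε₁ * ((1 - τ) * (N * l)))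
    (hye : N * (2 / g * ∑ j, |y j * e j|)
      ≤ ε₂ * (|y j₀ / e j₀| * ((1 - τ) * (N * l) * (1 - ε₁)))) :
    (y j₀ / e j₀) * (∑ j, y j * e j / (s - d j)) < 0 ∧
      (1 - τ) * (N * l) * (1 - ε₁) * (1 - ε₂) * |y j₀ / e j₀|
        ≤ N * |∑ j, y j * e j / (s - d j)| ∧
      N * |∑ j, y j * e j / (s - d j)|
        ≤ N * l * (1 + ε₁) * (1 + ε₂) * |y j₀ / e j₀| := by
  have ha : 0 < N * l := mul_pos hN hl
  set r := y j₀ / e j₀ with hr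
  have hr0 : 0 < |r| := abs_pos.2 (div_ne_zero hy h4)
  -- `R` and `E` collect the terms away from the pole `d j₀`.
  set R := N * ∑ j ∈ Finset.univ.erase j₀, e j ^ 2 / (s - d j) with hR
  set E := N * ∑ j ∈ Finset.univ.erase j₀, y j * e j / (s - d j) with hE
  have hRabs : |R| ≤ ε₁ * ((1 - τ) * (N * l)) := by
    have := abs_sum_erase_le hg h3 fun j => e j ^ 2
    simp only [abs_pow, sq_abs] at this
    rw [hR, abs_mul, abs_of_pos hN]
    exact (mul_le_mul_of_nonneg_left this hN.le).trans he
  have hEabs : |E| ≤ ε₂ * (|r| * ((1 - τ) * (N * l) * (1 - ε₁))) := by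
    rw [hE, abs_mul, abs_of_pos hN]
    exact (mul_le_mul_of_nonneg_left (abs_sum_erase_le hg h3 fun j => y j * e j) hN.le).trans hye
  have hsec : s - N * l = N * ∑ j, e j ^ 2 / (s - d j) := by
    have := secular_pairing h1 hs e
    rw [this] at h2
    simp only [sq]
    have h6 : S * (s - N * l) = S * (N * ∑ j, e j * e j / (s - d j)) := by linear_combination h2
    exact mul_left_cancel₀ hS h6
  -- The secular equation says that the pole term `N e_{j₀}² / (s - d_{j₀})` is `-Δ`. Multiplied by
  -- `r` it is the pole term of `N ω`, and `Δ` is close to `N l - s`, which lies between `(1 - τ) N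
  -- l` and `N l`.
  set Δ := N * l - s + R with hΔ
  have hsplit : N * (e j₀ ^ 2 / (s - d j₀)) = -Δ := by
    rw [← Finset.add_sum_erase _ _ (Finset.mem_univ j₀), mul_add, ← hR] at hsec
    linarith
  have hNω : N * (∑ j, y j * e j / (s - d j)) = -(r * Δ) + E := by
    rw [← Finset.add_sum_erase _ _ (Finset.mem_univ j₀), mul_add, ← hE]
    congr 1
    rw [← mul_neg, ← hsplit, hr]
    field_simp
  have hΔ1 : (1 - τ) * (N * l) * (1 - ε₁) ≤ Δ := by
    have := neg_le_of_abs_le hRabs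
    nlinarith
  have hΔ2 : Δ ≤ N * l * (1 + ε₁) := by
    have h7 := le_of_abs_le hRabs
    have h8 : 0 ≤ ε₁ * ((1 - τ) * (N * l)) := (abs_nonneg R).trans hRabs
    have h9 : 0 ≤ ε₁ := by
      by_contra hneg
      have := mul_pos (sub_pos.2 hτ) ha
      nlinarith
    nlinarith [mul_nonneg h9 (mul_nonneg hτ0 ha.le)]
  have hΔ0 : 0 < Δ := lt_of_lt_of_le
    (mul_pos (mul_pos (sub_pos.2 hτ) ha) (sub_pos.2 hε₁)) hΔ1
  have hEabs' : |E| ≤ ε₂ * (|r| * Δ) := hEabs.trans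
    (mul_le_mul_of_nonneg_left (mul_le_mul_of_nonneg_left hΔ1 hr0.le) hε₂0)
  set ω := ∑ j, y j * e j / (s - d j)
  have habs : N * |ω| = |-(r * Δ) + E| := by rw [← hNω, abs_mul, abs_of_pos hN]
  have hrΔ : |r * Δ| = |r| * Δ := by rw [abs_mul, abs_of_pos hΔ0]
  have hrΔ0 : 0 < |r| * Δ := mul_pos hr0 hΔ0
  refine ⟨?_, ?_, ?_⟩
  · have h7 : N * (r * ω) = -(|r| * (|r| * Δ)) + r * E := by
      have : |r| * |r| = r * r := abs_mul_abs_self r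
      linear_combination r * hNω + Δ * this
    have h8 : r * E ≤ |r| * (ε₂ * (|r| * Δ)) :=
      (le_abs_self _).trans (by rw [abs_mul]; exact mul_le_mul_of_nonneg_left hEabs' hr0.le)
    have h9 : N * (r * ω) < 0 := by
      have := mul_pos (mul_pos hr0 hrΔ0) (sub_pos.2 hε₂)
      nlinarith
    by_contra hneg
    exact absurd h9 (not_lt.2 (mul_nonneg hN.le (not_lt.1 hneg)))
  · rw [habs]
    have h7 : |r * Δ| - |E| ≤ |-(r * Δ) + E| := by
      have := abs_sub_abs_le_abs_sub (r * Δ) E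
      rwa [abs_sub_comm, show E - r * Δ = -(r * Δ) + E by ring] at this
    have h8 := mul_le_mul_of_nonneg_right hΔ1 (mul_nonneg (sub_nonneg.2 hε₂.le) hr0.le)
    linarith
  · rw [habs]
    have h7 := abs_add_le (-(r * Δ)) E
    rw [abs_neg] at h7
    have h8 := mul_le_mul_of_nonneg_right hΔ2 (mul_nonneg (by linarith : 0 ≤ 1 + ε₂) hr0.le)
    linarith

/-- A solution at `s = 0` has no component along the rank-one perturbation. -/
lemma secular_null (hg : 0 < g) (h1 : ∀ j, 0 = d j * u j + S * e j)
    (h2 : 0 = ∑ j, e j * u j + l * S) (hd : ∀ j, d j = 0 ∨ g ≤ d j)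
    (he : ∑ j, e j ^ 2 < g * l) : S = 0 ∧ ∀ j, d j ≠ 0 → u j = 0 := by
  have hS : S = 0 := by
    by_contra hS
    -- If `d j ≥ g`, then `S e = -d u` gives `(S e)² ≥ g d u² = -g S e u`. The sum over `j`, with `∑
    -- e u = -l S`, would give `g l ≤ ∑ e²`.
    have hterm : ∀ j, -(S ^ 2 * e j ^ 2) ≤ g * (S * (e j * u j)) := fun j => by
      have h3 := h1 j
      rcases hd j with hj | hj
      · rw [hj, zero_mul, zero_add] at h3
        have : e j = 0 := (mul_eq_zero.1 h3.symm).resolve_left hS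
        simp [this]
      · have hd0 : 0 < d j := hg.trans_le hj
        have h4 : S * e j = -(d j * u j) := by linarith
        have h5 : S ^ 2 * e j ^ 2 = d j ^ 2 * u j ^ 2 := by
          rw [← mul_pow, h4]; ring
        have h6 : S * (e j * u j) = -(d j * u j ^ 2) := by
          rw [← mul_assoc, h4]; ring
        rw [h5, h6]
        nlinarith [mul_nonneg (mul_nonneg hd0.le (sq_nonneg (u j))) (sub_nonneg.2 hj)]
    have hsum := Finset.sum_le_sum fun j (_ : j ∈ Finset.univ) => hterm j
    rw [← Finset.mul_sum, ← Finset.mul_sum, Finset.sum_neg_distrib, ← Finset.mul_sum] at hsum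
    have hS2 : 0 < S ^ 2 := by positivity
    have h7 : ∑ j, e j * u j = -(l * S) := by linarith
    rw [h7] at hsum
    nlinarith [mul_lt_mul_of_pos_left he hS2]
  refine ⟨hS, fun j hj => ?_⟩
  have := h1 j
  rw [hS, zero_mul, add_zero] at this
  exact (mul_eq_zero.1 this.symm).resolve_left hj

end Secular

/-! ### Interlacing with the unlabeled block, and its secular equations -/

section Interlacing

variable {Nl Nu n : ℕ} {A : Matrix (Point Nl Nu) (Point Nl Nu) ℝ} {σ : Fin n → ℝ}
  {V : Matrix (Point Nl Nu) (Fin n) ℝ} {d : Fin Nu → ℝ} {Q : Matrix (Fin Nu) (Fin Nu) ℝ}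

/-- Interlacing from above: one step down, the averaged matrix is dominated by the unlabeled
block. -/
lemma averaged_eigenvalue_le (hA : Aᵀ = A) (h : IsSpectral (averaged A) σ V)
    (hQ : IsSpectral (unlabeledBlock A) d Q) (i : Fin n) (hi : 0 < i.val) {μ : ℝ} (hμ0 : 0 ≤ μ)
    (hμ : ∀ j : Fin Nu, i.val ≤ j.val + 1 → d j ≤ μ) : σ i ≤ μ := by
  -- One constraint makes the labeled sum vanish, so that only the unlabeled block remains in the
  -- form. The others remove at most `i - 1` top eigenvectors of that block, whence the shift by
  -- one.
  let row : Option {j : Fin Nu // j.val + 1 < i.val} → Point Nl Nu → ℝ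
    | none => Sum.elim (fun _ => 1) (fun _ => 0)
    | some j => Sum.elim (fun _ => 0) (Q.col j.val)
  have hcard : Fintype.card (Option {j : Fin Nu // j.val + 1 < i.val}) ≤ i.val := by
    rw [Fintype.card_option]
    have : Fintype.card {j : Fin Nu // j.val + 1 < i.val} ≤ Fintype.card (Fin (i.val - 1)) :=
      Fintype.card_le_of_injective (fun j => (⟨j.val.val, by have := j.2; omega⟩ : Fin (i.val - 1)))
        fun a b hab => Subtype.ext (Fin.ext (by simpa using hab))
    rw [Fintype.card_fin] at this
    omega
  refine h.eigenvalue_le i hcard (Matrix.mulVecLin (Matrix.of row)) fun x hx => ?_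
  have hS : labeledSum x = 0 := by
    have := congr_fun hx none
    simpa [Matrix.mulVec, dotProduct, row, labeledSum] using this
  have hz : ∀ j : Fin Nu, j.val + 1 < i.val → (Qᵀ *ᵥ unlabeledPart x) j = 0 := fun j hj => by
    have := congr_fun hx (some ⟨j, hj⟩)
    simpa [Matrix.mulVec, dotProduct, row, unlabeledPart] using this
  rw [averaged_quadForm hA, hS, hQ.quadForm_eq]
  have h1 : ∑ j, d j * (Qᵀ *ᵥ unlabeledPart x) j ^ 2 ≤ μ * vnorm (unlabeledPart x) ^ 2 := by
    rw [hQ.vnorm_sq_eq, Finset.mul_sum]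
    refine Finset.sum_le_sum fun j _ => ?_
    by_cases hj : j.val + 1 < i.val
    · rw [hz j hj]; simp
    · exact mul_le_mul_of_nonneg_right (hμ j (not_lt.1 hj)) (sq_nonneg _)
  have h2 : vnorm (unlabeledPart x) ^ 2 ≤ vnorm x ^ 2 := by
    rw [vnorm_sq_sum]
    exact le_add_of_nonneg_left (Finset.sum_nonneg fun _ _ => sq_nonneg _)
  nlinarith [mul_le_mul_of_nonneg_left h2 hμ0]

/-- Interlacing from below, up to the size of the off-diagonal block. -/
lemma le_averaged_eigenvalue (hNl : 0 < Nl) (hA : Aᵀ = A) (h : IsSpectral (averaged A) σ V)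
    (hQ : IsSpectral (unlabeledBlock A) d Q) (i : Fin n) (j : Fin Nu) (hij : i.val = j.val + 1)
    {ρ : ℝ} (hρ0 : 0 ≤ ρ) (hρ : Nl * vnorm (etaU A) ^ 2 ≤ ρ ^ 2) (hd : d j ≤ Nl * etaL A) :
    d j - ρ ≤ σ i := by
  have hN : (0 : ℝ) < Nl := by exact_mod_cast hNl
  -- The test space has dimension `i + 1`: constants on the labeled points and the first `j + 1 = i`
  -- eigenvectors of the unlabeled block, `ext` padding by zeros.
  let ext : (Option (Fin (j.val + 1)) → ℝ) → Fin Nu → ℝ := fun c l =>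
    if hl : l.val < j.val + 1 then c (some ⟨l.val, hl⟩) else 0
  let T : (Option (Fin (j.val + 1)) → ℝ) →ₗ[ℝ] (Point Nl Nu → ℝ) :=
    { toFun := fun c => Sum.elim (fun _ => c none) (Q *ᵥ ext c)
      map_add' := fun a b => by
        have : ext (a + b) = ext a + ext b := by
          funext l
          simp only [ext, Pi.add_apply]
          split_ifs <;> simp
        funext x
        rcases x with x | x
        · rfl
        · simp only [this, Matrix.mulVec_add, Sum.elim_inr, Pi.add_apply]
      map_smul' := fun t a => by
        have : ext (t • a) = t • ext a := by
          funext l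
          simp only [ext, Pi.smul_apply]
          split_ifs <;> simp
        funext x
        rcases x with x | x
        · rfl
        · simp only [this, Matrix.mulVec_smul, Sum.elim_inr, Pi.smul_apply, RingHom.id_apply] }
  have hTl : ∀ c (p : Fin Nl), T c (Sum.inl p) = c none := fun _ _ => rfl
  have hTu : ∀ c, unlabeledPart (T c) = Q *ᵥ ext c := fun _ => rfl
  have hQT : ∀ c, Qᵀ *ᵥ unlabeledPart (T c) = ext c := fun c => by
    rw [hTu, hQ.transpose_mulVec_mulVec]
  refine h.le_eigenvalue i (by simp [hij]) T (fun c hc => ?_) fun c => ?_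
  · have h1 : ext c = 0 := by
      rw [← hQT c, hc]
      exact Matrix.mulVec_zero _
    funext o
    rcases o with _ | l
    · rw [← hTl c ⟨0, hNl⟩, hc]; rfl
    · have := congr_fun h1 ⟨l.val, by omega⟩
      have hl : l.val < j.val + 1 := l.isLt
      simp only [ext, dif_pos hl] at this
      exact this
  · set t := c none with ht
    have hS : labeledSum (T c) = Nl * t := by simp [labeledSum, hTl, ht]
    have hn : vnorm (T c) ^ 2 = Nl * t ^ 2 + vnorm (unlabeledPart (T c)) ^ 2 := by
      rw [vnorm_sq_sum]; simp [hTl, ht]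
    set U := unlabeledPart (T c) with hU
    have hq : d j * vnorm U ^ 2 ≤ U ⬝ᵥ (unlabeledBlock A *ᵥ U) := by
      rw [hQ.quadForm_eq, hQ.vnorm_sq_eq, Finset.mul_sum]
      refine Finset.sum_le_sum fun l _ => ?_
      rw [hQT c]
      by_cases hl : l.val < j.val + 1
      · exact mul_le_mul_of_nonneg_right (hQ.antitone (Fin.le_def.2 (by omega))) (sq_nonneg _)
      · simp only [ext, dif_neg hl]; simp
    rw [averaged_quadForm hA, hS, hn]
    have hc := abs_dotProduct_le (etaU A) U
    -- Split `Nl = √Nl * √Nl`: one factor normalizes the constant vector, the other turns `‖η‖` into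
    -- a quantity bounded by `ρ`.
    have hcross : -(ρ * (Nl * t ^ 2 + vnorm U ^ 2)) ≤ 2 * (Nl * t) * (etaU A ⬝ᵥ U) := by
      have hs := Real.sq_sqrt hN.le
      have hs0 := Real.sqrt_nonneg (Nl : ℝ)
      set q := Real.sqrt (Nl : ℝ)
      have h1 : q * vnorm (etaU A) ≤ ρ :=
        le_of_sq_le_sq (by rw [mul_pow, hs]; exact hρ) hρ0
      have h2 : |2 * (Nl * t) * (etaU A ⬝ᵥ U)| ≤ 2 * (q * |t|) * (vnorm U * (q * vnorm (etaU A))) := by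
        rw [abs_mul, abs_mul, abs_mul, abs_of_pos hN, abs_two]
        calc 2 * (Nl * |t|) * |etaU A ⬝ᵥ U| ≤ 2 * (Nl * |t|) * (vnorm (etaU A) * vnorm U) :=
              mul_le_mul_of_nonneg_left hc (by positivity)
          _ = _ := by rw [← hs]; ring
      have h3 : 2 * (q * |t|) * (vnorm U * (q * vnorm (etaU A)))
          ≤ 2 * (q * |t|) * (vnorm U * ρ) :=
        mul_le_mul_of_nonneg_left (mul_le_mul_of_nonneg_left h1 (vnorm_nonneg _)) (by positivity)
      have h4 : 2 * (q * |t|) * vnorm U ≤ Nl * t ^ 2 + vnorm U ^ 2 := by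
        have : (q * |t|) ^ 2 = Nl * t ^ 2 := by rw [mul_pow, hs, sq_abs]
        nlinarith [sq_nonneg (q * |t| - vnorm U)]
      have h5 := mul_le_mul_of_nonneg_right h4 hρ0
      have h6 := neg_le_of_abs_le (h2.trans h3)
      linarith
    have h7 : d j * (Nl * t ^ 2) ≤ etaL A * (Nl * t) ^ 2 := by
      nlinarith [mul_le_mul_of_nonneg_right hd (show 0 ≤ Nl * t ^ 2 by positivity)]
    linarith

lemma averaged_secular (hQ : IsSpectral (unlabeledBlock A) d Q)
    (h : IsSpectral (averaged A) σ V) (i : Fin n) (j : Fin Nu) :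
    σ i * (Qᵀ *ᵥ unlabeledPart (V.col i)) j = d j * (Qᵀ *ᵥ unlabeledPart (V.col i)) j
      + labeledSum (V.col i) * (etaU A ⬝ᵥ Q.col j) := by
  have h1 := congr_arg (fun z => (Qᵀ *ᵥ z) j) (averaged_eigen_inr h i)
  simp only [Matrix.mulVec_smul, Matrix.mulVec_add, Pi.add_apply, Pi.smul_apply,
    smul_eq_mul] at h1
  rw [h1]
  congr 1
  · conv_lhs => rw [hQ.eq_spectralFun]
    rw [hQ.transpose_spectralFun]
  · rw [dotProduct_comm]; rfl

lemma averaged_secular_labeled (hA : Aᵀ = A) (hQ : IsSpectral (unlabeledBlock A) d Q)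
    (h : IsSpectral (averaged A) σ V) (i : Fin n) :
    σ i * labeledSum (V.col i) = Nl * (∑ j, (etaU A ⬝ᵥ Q.col j)
      * (Qᵀ *ᵥ unlabeledPart (V.col i)) j + etaL A * labeledSum (V.col i)) := by
  have h1 : etaU A ⬝ᵥ unlabeledPart (V.col i)
      = ∑ j, (etaU A ⬝ᵥ Q.col j) * (Qᵀ *ᵥ unlabeledPart (V.col i)) j := by
    rw [← hQ.dotProduct_transpose]
    refine Finset.sum_congr rfl fun j _ => ?_
    rw [dotProduct_comm (etaU A)]; rfl
  rw [← h1, show σ i * labeledSum (V.col i) = ∑ p : Fin Nl, σ i * V (Sum.inl p) i from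
    Finset.mul_sum _ _ _]
  simp only [averaged_eigen_inl hA h i, Finset.sum_const, Finset.card_univ, Fintype.card_fin,
    nsmul_eq_mul]

lemma ignorance_eq (hQ : IsSpectral (unlabeledBlock A) d Q) (k : ℕ)
    (V : Matrix (Point Nl Nu) (Fin n) ℝ) (y : Fin Nu → ℝ) (i : Rest n k) :
    ignorance k V y i = ∑ j, (y ⬝ᵥ Q.col j) * (Qᵀ *ᵥ unlabeledPart (V.col i.val)) j := by
  have h1 : ignorance k V y i = y ⬝ᵥ unlabeledPart (V.col i.val) :=
    Finset.sum_congr rfl fun x _ => mul_comm _ _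
  rw [h1, ← hQ.dotProduct_transpose]
  refine Finset.sum_congr rfl fun j _ => ?_
  rw [dotProduct_comm y]; rfl

lemma sum_dotProduct_col_sq {ι : Type*} [Fintype ι] [DecidableEq ι] {B : Matrix ι ι ℝ}
    {δ : Fin n → ℝ} {W : Matrix ι (Fin n) ℝ} (hW : IsSpectral B δ W) (z : ι → ℝ) :
    ∑ j, (z ⬝ᵥ W.col j) ^ 2 = vnorm z ^ 2 := by
  rw [hW.vnorm_sq_eq]
  refine Finset.sum_congr rfl fun j _ => ?_
  rw [dotProduct_comm]; rfl

lemma sum_abs_mul_dotProduct_col_le {ι : Type*} [Fintype ι] [DecidableEq ι] {B : Matrix ι ι ℝ}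
    {δ : Fin n → ℝ} {W : Matrix ι (Fin n) ℝ} (hW : IsSpectral B δ W) (y z : ι → ℝ) :
    ∑ j, |(y ⬝ᵥ W.col j) * (z ⬝ᵥ W.col j)| ≤ vnorm y * vnorm z := by
  refine le_of_sq_le_sq ?_ (mul_nonneg (vnorm_nonneg _) (vnorm_nonneg _))
  rw [mul_pow, ← sum_dotProduct_col_sq hW, ← sum_dotProduct_col_sq hW]
  have := Finset.sum_mul_sq_le_sq_mul_sq Finset.univ (fun j => |y ⬝ᵥ W.col j|)
    fun j => |z ⬝ᵥ W.col j|
  simpa only [abs_mul, sq_abs] using this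

end Interlacing

/-! ### The lower bound on the coverage -/

section Coverage

variable {Nl Nu n k : ℕ} {A : Matrix (Point Nl Nu) (Point Nl Nu) ℝ} {σ : Fin n → ℝ}
  {V : Matrix (Point Nl Nu) (Fin n) ℝ} {d : Fin Nu → ℝ} {Q : Matrix (Fin Nu) (Fin Nu) ℝ}
  {g b h τ M : ℝ} {y : Fin Nu → ℝ}

/-- An eigenvalue of the averaged matrix beyond the top `k` that does not vanish lies just below
the preceding eigenvalue of the unlabeled block. -/
lemma exists_low_index (hNl : 0 < Nl) (hk : 0 < k) (hA : Aᵀ = A)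
    (hpos : ∀ x, 0 ≤ x ⬝ᵥ (A *ᵥ x)) (hV : IsSpectral (averaged A) σ V)
    (hQ : IsSpectral (unlabeledBlock A) d Q) (hη : 0 < etaL A) (hτ : τ < 1)
    (hdτ : ∀ j : Fin Nu, k ≤ j.val + 1 → d j ≤ τ * (Nl * etaL A)) {ρ : ℝ} (hρ0 : 0 ≤ ρ)
    (hρ : Nl * vnorm (etaU A) ^ 2 ≤ ρ ^ 2) {i : Fin n} (hik : k ≤ i.val) (hσi : σ i ≠ 0) :
    ∃ j : Fin Nu, k ≤ j.val + 1 ∧ 0 < d j ∧ σ i ≤ d j ∧ d j - ρ ≤ σ i := by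
  have hσ0 := hV.eigenvalue_nonneg (averaged_quadForm_nonneg hNl hA hpos)
  have hσi0 : 0 < σ i := lt_of_le_of_ne (hσ0 i) (Ne.symm hσi)
  have hd0 := hQ.eigenvalue_nonneg (unlabeledBlock_quadForm_nonneg hNl hA hpos)
  have hN : (0 : ℝ) < Nl := by exact_mod_cast hNl
  -- Beyond `Nu` no `d j` is left in the interlacing bound, so the eigenvalue would be at most zero.
  have hiN : i.val ≤ Nu := by
    by_contra hi
    exact absurd (averaged_eigenvalue_le hA hV hQ i (by omega) le_rfl
      fun j hj => absurd j.isLt (by omega)) (not_le.2 hσi0)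
  set j : Fin Nu := ⟨i.val - 1, by omega⟩ with hj
  have hle : σ i ≤ d j := averaged_eigenvalue_le hA hV hQ i (by omega) (hd0 j)
    fun l hl => hQ.antitone (Fin.le_def.2 (by simp only [hj]; omega))
  have hkj : k ≤ j.val + 1 := by simp only [hj]; omega
  refine ⟨j, hkj, hσi0.trans_le hle, hle, ?_⟩
  refine le_averaged_eigenvalue hNl hA hV hQ i j (by simp only [hj]; omega) hρ0 hρ ?_
  have := hdτ j hkj
  have := mul_pos hN hη
  nlinarith

end Coverage

section Coverage

variable {Nl Nu n k : ℕ} {A : Matrix (Point Nl Nu) (Point Nl Nu) ℝ} {σ : Fin n → ℝ}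
  {V : Matrix (Point Nl Nu) (Fin n) ℝ} {d : Fin Nu → ℝ} {Q : Matrix (Fin Nu) (Fin Nu) ℝ}
  {g b h τ M : ℝ} {y : Fin Nu → ℝ}

lemma vnorm_sq_le_of_le {ι : Type*} [Fintype ι] {v : ι → ℝ} {c : ℝ} (h0 : ∀ x, 0 ≤ v x)
    (hc : ∀ x, v x ≤ c) : vnorm v ^ 2 ≤ Fintype.card ι * c ^ 2 := by
  rw [vnorm_sq, dotProduct, ← nsmul_eq_mul]
  refine Finset.sum_le_card_nsmul _ _ _ fun x _ => ?_
  rw [← sq]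
  exact pow_le_pow_left₀ (h0 x) (hc x) 2

lemma vnorm_etaU_sq_le (hη0 : ∀ x, 0 ≤ etaU A x) (hηM : ∀ x, etaU A x ≤ 1 / M) :
    vnorm (etaU A) ^ 2 ≤ Nu / M ^ 2 := by
  refine (vnorm_sq_le_of_le hη0 hηM).trans (le_of_eq ?_)
  rw [Fintype.card_fin]
  ring

lemma vnorm_mul_vnorm_etaU_le (hM : 0 < M) (hη0 : ∀ x, 0 ≤ etaU A x)
    (hηM : ∀ x, etaU A x ≤ 1 / M) (hy : ∀ x, y x = 0 ∨ y x = 1) :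
    vnorm y * vnorm (etaU A) ≤ Nu / M := by
  have h1 : vnorm y ^ 2 ≤ Nu := by
    refine (vnorm_sq_le_of_le (c := 1) (fun x => ?_) fun x => ?_).trans (by simp)
    · rcases hy x with h | h <;> simp [h]
    · rcases hy x with h | h <;> simp [h]
  refine le_of_sq_le_sq ?_ (by positivity)
  rw [mul_pow]
  calc _ ≤ (Nu : ℝ) * (Nu / M ^ 2) :=
        mul_le_mul h1 (vnorm_etaU_sq_le hη0 hηM) (sq_nonneg _) (Nat.cast_nonneg _)
    _ = _ := by ring

/-- The eigenvectors beyond the top `k` with a nonzero eigenvalue: the resolvent value is, up to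
sign and small relative errors, a bounded multiple of the ratio at a low position. -/
lemma exists_low_index_resolvent (hNl : 0 < Nl) (hNu : 0 < Nu) (hk : 0 < k) (hA : Aᵀ = A)
    (hpos : ∀ x, 0 ≤ x ⬝ᵥ (A *ᵥ x)) (hV : IsSpectral (averaged A) σ V)
    (hQ : IsSpectral (unlabeledBlock A) d Q) (hg : 0 < g) (hb : 0 < b) (hh : 0 < h)
    (hη : h ≤ etaL A) (hτ : τ < 1)
    (hdτ : ∀ j : Fin Nu, k ≤ j.val + 1 → d j ≤ τ * (Nl * etaL A)) (hM : 0 < M)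
    (hη0 : ∀ x, 0 ≤ etaU A x) (hηM : ∀ x, etaU A x ≤ 1 / M) (hy : ∀ x, y x = 0 ∨ y x = 1)
    (hgen : IsGeneric k g b d Q (etaU A) y) (hC : 4 * (Nl * Nu) / g ^ 2 ≤ M ^ 2) {ε₁ ε₂ : ℝ}
    (hε₁ : ε₁ = 2 * Nu / (g * (1 - τ) * h) / M ^ 2)
    (hε₂ : ε₂ = 4 * Nu ^ 2 / (g * b * (1 - τ) * h) / M ^ 2)
    (hε₁' : ε₁ ≤ 1 / 2) (hε₂' : ε₂ ≤ 1 / 2) {i : Fin n} (hik : k ≤ i.val) (hσi : σ i ≠ 0) :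
    labeledSum (V.col i) ≠ 0 ∧ (∀ j, σ i - d j ≠ 0) ∧ ∃ j : LowIndex k d,
      eigRatio Q (etaU A) y j.val * resolventValue d Q (etaU A) y (σ i) < 0 ∧
      (1 - τ) * (Nl * etaL A) * (1 - ε₁) * (1 - ε₂) * |eigRatio Q (etaU A) y j.val|
        ≤ Nl * |resolventValue d Q (etaU A) y (σ i)| ∧
      Nl * |resolventValue d Q (etaU A) y (σ i)|
        ≤ Nl * etaL A * (1 + ε₁) * (1 + ε₂) * |eigRatio Q (etaU A) y j.val| := by
  have hN : (0 : ℝ) < Nl := by exact_mod_cast hNl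
  have hNu' : (0 : ℝ) < Nu := by exact_mod_cast hNu
  have hNu1 : (1 : ℝ) ≤ Nu := by exact_mod_cast hNu
  have hτ' : 0 < 1 - τ := sub_pos.2 hτ
  have hl : 0 < etaL A := hh.trans_le hη
  have ha : 0 < Nl * etaL A := mul_pos hN hl
  have hvη := vnorm_etaU_sq_le hη0 hηM
  have hρ : Nl * vnorm (etaU A) ^ 2 ≤ (g / 2) ^ 2 := by
    rw [div_le_iff₀ (by positivity)] at hC
    calc Nl * vnorm (etaU A) ^ 2 ≤ Nl * (Nu / M ^ 2) := mul_le_mul_of_nonneg_left hvη hN.le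
      _ = Nl * Nu / M ^ 2 := by ring
      _ ≤ _ := by rw [div_le_iff₀ (by positivity)]; linarith
  -- With `ρ = g / 2` the eigenvalue stays within `g / 2` of `d j`, hence at least `g / 2` away from
  -- every other `d l`.
  obtain ⟨j, hkj, hdj, hle, hge⟩ := exists_low_index hNl hk hA hpos hV hQ hl hτ hdτ
    (by positivity : 0 ≤ g / 2) hρ hik hσi
  have hσ0 := hV.eigenvalue_nonneg (averaged_quadForm_nonneg hNl hA hpos) i
  have hτ0 : 0 ≤ τ := by
    by_contra hneg
    have := hdτ j hkj
    have := mul_neg_of_neg_of_pos (not_le.1 hneg) ha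
    linarith
  have hsep : ∀ l, l ≠ j → g / 2 ≤ |σ i - d l| := fun l hl => by
    have h1 := hgen.separated l j hkj hdj hl
    have h2 := abs_sub_le (d l) (σ i) (d j)
    have h3 : |σ i - d j| ≤ g / 2 := abs_le.2 ⟨by linarith, by linarith⟩
    rw [abs_sub_comm (d l) (σ i)] at h2
    linarith
  have hej := hgen.eta_ne j hkj hdj
  have hyj := hgen.y_lower j hkj hdj
  have hsec1 := averaged_secular hQ hV i
  have hsec2 := averaged_secular_labeled hA hQ hV i
  have hne := secular_ne_zero hN.ne' hg hsec1 hsec2 hsep hej fun hS hu => by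
    have h1 : unlabeledPart (V.col i) = 0 := by
      rw [← hQ.mulVec_transpose_mulVec (unlabeledPart (V.col i)), hu, Matrix.mulVec_zero]
    have h2 := labeledSum_sq hNl hA hV hσi
    have h3 : ∑ x : Fin Nu, V (Sum.inr x) i ^ 2 = 0 :=
      Finset.sum_eq_zero fun x _ => by
        have := congr_fun h1 x
        rw [show V (Sum.inr x) i = 0 from this]
        simp
    rw [h3, hS] at h2
    linarith
  have hε₁0 : 0 ≤ ε₁ := by rw [hε₁]; positivity
  have hε₂0 : 0 ≤ ε₂ := by rw [hε₂]; positivity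
  have hsume := sum_dotProduct_col_sq hQ (etaU A)
  have hbd := secular_resolvent_bounds (y := fun j => y ⬝ᵥ Q.col j) (τ := τ) (ε₁ := ε₁)
    (ε₂ := ε₂) hN hg hl hsec1 hsec2 hsep hej hne.1 hne.2 hσ0 (hle.trans (hdτ j hkj)) hτ0 hτ
    (fun h0 => by simp only [h0, abs_zero] at hyj; linarith) (by linarith) hε₂0 (by linarith)
    (by
      rw [hsume]
      calc Nl * (2 / g * vnorm (etaU A) ^ 2) ≤ Nl * (2 / g * (Nu / M ^ 2)) := by gcongr
        _ = ε₁ * ((1 - τ) * (Nl * h)) := by rw [hε₁]; field_simp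
        _ ≤ _ := by gcongr)
    (by
      -- This forces `|r_j| ≥ b M / Nu`. Compared with it, the terms off the pole, of order `1 / M`,
      -- have relative size `1 / M²`.
      have h1 : |etaU A ⬝ᵥ Q.col j| ≤ Nu / M := by
        refine abs_le_of_sq_le_sq ?_ (by positivity)
        have h2 : (etaU A ⬝ᵥ Q.col j) ^ 2 ≤ ∑ l, (etaU A ⬝ᵥ Q.col l) ^ 2 :=
          Finset.single_le_sum (f := fun l => (etaU A ⬝ᵥ Q.col l) ^ 2)
            (fun _ _ => sq_nonneg _) (Finset.mem_univ j)
        rw [hsume] at h2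
        refine h2.trans (hvη.trans ?_)
        rw [div_pow]
        gcongr
        nlinarith
      have h2 : b * M / Nu ≤ |(y ⬝ᵥ Q.col j) / (etaU A ⬝ᵥ Q.col j)| := by
        rw [abs_div, div_le_div_iff₀ hNu' (abs_pos.2 hej)]
        calc b * M * |etaU A ⬝ᵥ Q.col j| ≤ b * M * (Nu / M) := by gcongr
          _ = b * Nu := by field_simp
          _ ≤ _ := by gcongr
      calc Nl * (2 / g * ∑ l, |(y ⬝ᵥ Q.col l) * (etaU A ⬝ᵥ Q.col l)|)
          ≤ Nl * (2 / g * (Nu / M)) := by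
            gcongr
            exact (sum_abs_mul_dotProduct_col_le hQ y (etaU A)).trans
              (vnorm_mul_vnorm_etaU_le hM hη0 hηM hy)
        _ = ε₂ * (b * M / Nu * ((1 - τ) * (Nl * h) * (1 - 1 / 2))) := by
            rw [hε₂]; field_simp; norm_num
        _ ≤ _ := by
            have h3 : (1 : ℝ) - 1 / 2 ≤ 1 - ε₁ := by linarith
            gcongr)
  exact ⟨hne.1, hne.2, ⟨j, hkj, hdj⟩, hbd⟩

/-- Null vectors of the averaged matrix contribute neither ignorance nor knowledge. -/
lemma ignorance_knowledge_null (hNl : 0 < Nl) (hA : Aᵀ = A) (hpos : ∀ x, 0 ≤ x ⬝ᵥ (A *ᵥ x))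
    (hV : IsSpectral (averaged A) σ V) (hQ : IsSpectral (unlabeledBlock A) d Q) (hg : 0 < g)
    (hη : vnorm (etaU A) ^ 2 < g * etaL A) (hgen : IsGeneric k g b d Q (etaU A) y)
    (j₀ : LowIndex k d) (i : Rest n k) (hσi : σ i.val = 0) :
    ignorance k V y i = 0 ∧ labeledSum (V.col i.val) = 0 := by
  have hN : (Nl : ℝ) ≠ 0 := by exact_mod_cast hNl.ne'
  have hd0 := hQ.eigenvalue_nonneg (unlabeledBlock_quadForm_nonneg hNl hA hpos)
  -- Earlier positions inherit the bound at `j₀` by monotonicity, so null eigenvalues occur only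
  -- where `y_null` applies.
  have htop : ∀ j : Fin Nu, ¬ k ≤ j.val + 1 → g ≤ d j := fun j hj =>
    (hgen.lower j₀.val j₀.2.1 j₀.2.2).trans
      (hQ.antitone (Fin.le_def.2 (by have := j₀.2.1; omega)))
  have hd : ∀ j, d j = 0 ∨ g ≤ d j := fun j => by
    by_cases hj : k ≤ j.val + 1
    · rcases (hd0 j).eq_or_lt with h0 | h0
      · exact Or.inl h0.symm
      · exact Or.inr (hgen.lower j hj h0)
    · exact Or.inr (htop j hj)
  have hsec1 := averaged_secular hQ hV i.val
  have hsec2 := averaged_secular_labeled hA hQ hV i.val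
  rw [hσi, zero_mul] at hsec2
  simp only [hσi, zero_mul] at hsec1
  obtain ⟨hS, hu⟩ := secular_null hg hsec1
    ((mul_eq_zero.1 hsec2.symm).resolve_left hN).symm hd
    (by rw [sum_dotProduct_col_sq hQ]; exact hη)
  refine ⟨?_, hS⟩
  rw [ignorance_eq hQ]
  refine Finset.sum_eq_zero fun j _ => ?_
  rcases eq_or_ne (d j) 0 with hj | hj
  · have hkj : k ≤ j.val + 1 := by
      by_contra hkj
      have := htop j hkj
      linarith
    rw [hgen.y_null j hkj hj, zero_mul]
  · rw [hu j hj, mul_zero]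

lemma ratioFloor_le (r : Fin Nu → ℝ) (i j : LowIndex k d) :
    ratioFloor k d r ≤ 2 * Real.sqrt (r i.val * r j.val) / |r i.val + r j.val| :=
  ciInf_le (f := fun p : LowIndex k d × LowIndex k d =>
    2 * Real.sqrt (r p.1.val * r p.2.val) / |r p.1.val + r p.2.val|)
    (Set.finite_range _).bddBelow (i, j)

lemma cosine_neg_left {ι : Type*} [Fintype ι] (v w : ι → ℝ) : cosine (-v) w = -cosine v w := by
  rw [cosine, cosine, neg_dotProduct, show vnorm (-v) = vnorm v by simp [vnorm], neg_div]

/-- The first summand of `C` keeps the interlacing error below `g / 2`, the second gives `‖η‖² < g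
η_l`, which disposes of null vectors, and the last two give `2 ε₁ + 2 ε₂ ≤ C / M²`. -/
theorem coverage_lower_bound (hNl : 0 < Nl) (hNu : 0 < Nu) (hk : 0 < k) (hg : 0 < g) (hb : 0 < b)
    (hh : 0 < h) (hτ : τ < 1) (hA : Aᵀ = A)
    (hpos : ∀ x, 0 ≤ x ⬝ᵥ (A *ᵥ x)) (hV : IsSpectral (averaged A) σ V)
    (hm : labeledMass k σ V ≠ 0)
    (hQ : IsSpectral (unlabeledBlock A) d Q)
    (hη : h ≤ etaL A)
    (hdτ : ∀ j : Fin Nu, k ≤ j.val + 1 → d j ≤ τ * (Nl * etaL A)) (hM : 0 < M)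
    (hη0 : ∀ x, 0 ≤ etaU A x) (hηM : ∀ x, etaU A x ≤ 1 / M) (hy : ∀ x, y x = 0 ∨ y x = 1)
    (hgen : IsGeneric k g b d Q (etaU A) y) {C : ℝ}
    (hC : C = 4 * (Nl * Nu) / g ^ 2 + 2 * Nu / (g * h) + 2 * (2 * Nu / (g * (1 - τ) * h))
      + 2 * (4 * Nu ^ 2 / (g * b * (1 - τ) * h))) (hCM : C ≤ M ^ 2) :
    (1 - C / M ^ 2) * Real.sqrt (1 - τ) * ratioFloor k d (eigRatio Q (etaU A) y)
        ≤ |coverage k V y| ∧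
      ((∀ i ∈ restSupport k σ, 0 < resolventValue d Q (etaU A) y (σ i)) →
        (1 - C / M ^ 2) * Real.sqrt (1 - τ) * ratioFloor k d (eigRatio Q (etaU A) y)
          ≤ coverage k V y) := by
  have hN : (0 : ℝ) < Nl := by exact_mod_cast hNl
  have hNu' : (0 : ℝ) < Nu := by exact_mod_cast hNu
  have hτ' : 0 < 1 - τ := sub_pos.2 hτ
  have hl : 0 < etaL A := hh.trans_le hη
  have ha : 0 < Nl * etaL A := mul_pos hN hl
  have hM2 : 0 < M ^ 2 := by positivity
  set K₁ := 2 * Nu / (g * (1 - τ) * h) with hK₁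
  set K₂ := 4 * Nu ^ 2 / (g * b * (1 - τ) * h) with hK₂
  have hK₁0 : 0 < K₁ := by positivity
  have hK₂0 : 0 < K₂ := by positivity
  have hc1 : 0 < 4 * (Nl * Nu) / g ^ 2 := by positivity
  have hc2 : 0 < 2 * Nu / (g * h) := by positivity
  set ε₁ := K₁ / M ^ 2 with hε₁
  set ε₂ := K₂ / M ^ 2 with hε₂
  have hCM1 : C / M ^ 2 ≤ 1 := (div_le_one hM2).2 hCM
  have hCε : 2 * ε₁ + 2 * ε₂ ≤ C / M ^ 2 := by
    rw [show 2 * ε₁ + 2 * ε₂ = (2 * K₁ + 2 * K₂) / M ^ 2 by rw [hε₁, hε₂]; ring]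
    gcongr
    linarith
  have hε₁0 : 0 < ε₁ := by positivity
  have hε₂0 : 0 < ε₂ := by positivity
  have hlow := fun (i : Fin n) (hik : k ≤ i.val) (hσi : σ i ≠ 0) =>
    exists_low_index_resolvent hNl hNu hk hA hpos hV hQ hg hb hh hη hτ hdτ hM hη0 hηM hy hgen
      (by linarith) hε₁ hε₂ (by linarith) (by linarith) hik hσi
  obtain ⟨i₀, hi₀⟩ : (restSupport k σ).Nonempty := by
    rw [Finset.nonempty_iff_ne_empty]
    intro he
    exact hm (by simp [labeledMass, he])
  have hmem : ∀ {i}, i ∈ restSupport k σ → k ≤ i.val ∧ σ i ≠ 0 := fun hi => by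
    simpa [restSupport] using hi
  obtain ⟨-, -, j₀, -⟩ := hlow i₀ (hmem hi₀).1 (hmem hi₀).2
  have hτ0 : 0 < τ := by
    by_contra hneg
    have h1 := hdτ j₀.val j₀.2.1
    have h2 := j₀.2.2
    have := mul_nonneg (neg_nonneg.2 (not_lt.1 hneg)) ha.le
    linarith
  have hηg : vnorm (etaU A) ^ 2 < g * etaL A := by
    have h1 : 2 * Nu / (g * h) ≤ M ^ 2 := by linarith
    rw [div_le_iff₀ (by positivity)] at h1
    have h2 : Nu / M ^ 2 < g * h := by
      rw [div_lt_iff₀ hM2]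
      linarith
    exact (vnorm_etaU_sq_le hη0 hηM).trans_lt (h2.trans_le (mul_le_mul_of_nonneg_left hη hg.le))
  have hnull := fun i (hσi : σ (Subtype.val i) = 0) =>
    ignorance_knowledge_null hNl hA hpos hV hQ hg hηg hgen j₀ i hσi
  set η := etaU A
  set r := eigRatio Q η y with hr
  set x : Rest n k → ℝ := fun i => resolventValue d Q η y (σ i.val) with hx
  -- The entrywise proportionality that the Kantorovich inequality needs; at null indices both sides
  -- vanish.
  have hign : ∀ i, ignorance k V y i = knowledge k V i * x i := fun i => by
    by_cases hσi : σ i.val = 0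
    · rw [(hnull i hσi).1, show knowledge k V i = 0 from (hnull i hσi).2, zero_mul]
    · rw [ignorance_eq hQ]
      exact secular_pairing (averaged_secular hQ hV i.val) (hlow i.val i.2 hσi).2.1 _
  set F := ratioFloor k d r with hF
  have hfac : 0 ≤ (1 - C / M ^ 2) * Real.sqrt (1 - τ) :=
    mul_nonneg (sub_nonneg.2 hCM1) (Real.sqrt_nonneg _)
  have hfirst : (1 - C / M ^ 2) * Real.sqrt (1 - τ) * F ≤ |coverage k V y| := by
    by_cases hsign : ∃ i j : LowIndex k d, r i.val * r j.val ≤ 0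
    · obtain ⟨i, j, hij⟩ := hsign
      -- The square root of a nonpositive number is zero, so the floor is at most zero here.
      have h1 := ratioFloor_le r i j
      rw [Real.sqrt_eq_zero_of_nonpos hij, mul_zero, zero_div] at h1
      exact (mul_nonpos_of_nonneg_of_nonpos hfac h1).trans (abs_nonneg _)
    · push Not at hsign
      set t := (1 - τ) * (1 - C / M ^ 2) with ht
      have ht0 : 0 ≤ t := mul_nonneg hτ'.le (sub_nonneg.2 hCM1)
      have hCM0 : 0 ≤ C / M ^ 2 := by linarith
      have ht1 : t ≤ 1 := mul_le_one₀ (by linarith) (sub_nonneg.2 hCM1) (by linarith)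
      -- A number in `[0, 1]` is at most its square root, applied to `1 - C / M²`.
      have hst : (1 - C / M ^ 2) * Real.sqrt (1 - τ) ≤ Real.sqrt t := by
        rw [ht, Real.sqrt_mul hτ'.le, mul_comm]
        refine mul_le_mul_of_nonneg_left (Real.le_sqrt_of_sq_le ?_) (Real.sqrt_nonneg _)
        nlinarith
      have htL : t * (Nl * etaL A * (1 + ε₁) * (1 + ε₂))
          ≤ (1 - τ) * (Nl * etaL A) * (1 - ε₁) * (1 - ε₂) := by
        have h1 : (1 - C / M ^ 2) * ((1 + ε₁) * (1 + ε₂)) ≤ (1 - ε₁) * (1 - ε₂) := by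
          have h2 : (1 - C / M ^ 2) * ((1 + ε₁) * (1 + ε₂))
              ≤ (1 - (2 * ε₁ + 2 * ε₂)) * ((1 + ε₁) * (1 + ε₂)) := by gcongr
          have : 0 < ε₁ * ε₂ := by positivity
          nlinarith [mul_pos this hε₁0, mul_pos this hε₂0]
        have := mul_le_mul_of_nonneg_left h1 (mul_pos hτ' ha).le
        rw [ht]
        linarith
      let s : Finset (Rest n k) := Finset.univ.filter fun i => σ i.val ≠ 0
      have hs : s.Nonempty := ⟨⟨i₀, (hmem hi₀).1⟩, by simp [s, (hmem hi₀).2]⟩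
      -- Used with `x' = x` or `x' = -x`: all ratios share one sign, and the resolvent values have
      -- the opposite one.
      have hcos : ∀ x' : Rest n k → ℝ, (∀ i ∈ s, x' i = |x i|) →
          (∀ i, i ∉ s → knowledge k V i = 0) →
          (1 - C / M ^ 2) * Real.sqrt (1 - τ) * F
            ≤ cosine (fun i => knowledge k V i * x' i) (knowledge k V) := by
        intro x' hx' hout
        refine le_cosine_of_forall_ratio hs hout (fun i hi => ?_) (fun _ => rfl)
          (fun i hi => ?_) fun i hi j hj hij => ?_
        · exact (hlow i.val i.2 (by simpa [s] using hi)).1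
        · obtain ⟨-, -, l, hl1, -⟩ := hlow i.val i.2 (by simpa [s] using hi)
          rw [hx' i hi]
          exact abs_pos.2 fun h0 => by
            rw [show resolventValue d Q η y (σ i.val) = 0 from h0, mul_zero] at hl1
            exact lt_irrefl _ hl1
        · obtain ⟨-, -, l, hl1, hl2, -⟩ := hlow i.val i.2 (by simpa [s] using hi)
          obtain ⟨-, -, l', hl1', -, hl3'⟩ := hlow j.val j.2 (by simpa [s] using hj)
          have hrl : 0 < |r l.val| := abs_pos.2 (left_ne_zero_of_mul hl1.ne)
          have hrl' : 0 < |r l'.val| := abs_pos.2 (left_ne_zero_of_mul hl1'.ne)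
          have hxi : 0 < |x i| := abs_pos.2 (right_ne_zero_of_mul hl1.ne)
          rw [hx' i hi, hx' j hj] at *
          have h1 := kantorovich_ratio_le hrl hrl' (mul_pos hN hxi)
            (mul_le_mul_of_nonneg_left hij hN.le) ht0 ht1 htL hl2 hl3'
          have h2 : |r l.val| * |r l'.val| = r l.val * r l'.val := by
            rw [← abs_mul, abs_of_pos (hsign l l')]
          have h3 : |r l.val| + |r l'.val| = |r l.val + r l'.val| := by
            rw [(abs_add_eq_add_abs_iff _ _).2]
            rcases pos_and_pos_or_neg_and_neg_of_mul_pos (hsign l l') with hp | hp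
            · exact Or.inl ⟨hp.1.le, hp.2.le⟩
            · exact Or.inr ⟨hp.1.le, hp.2.le⟩
          have h4 : 2 * Real.sqrt (Nl * |x i| * (Nl * |x j|)) / (Nl * |x i| + Nl * |x j|)
              = 2 * Real.sqrt (|x i| * |x j|) / (|x i| + |x j|) := by
            rw [show (Nl : ℝ) * |x i| * (Nl * |x j|) = Nl ^ 2 * (|x i| * |x j|) by ring,
              Real.sqrt_mul (by positivity), Real.sqrt_sq hN.le]
            field_simp
          rw [h2, h3, h4] at h1
          refine le_trans ?_ h1
          refine (mul_le_mul_of_nonneg_left (ratioFloor_le r l l') hfac).trans ?_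
          exact mul_le_mul_of_nonneg_right hst (by positivity)
      have hout : ∀ i, i ∉ s → knowledge k V i = 0 := fun i hi =>
        (hnull i (by simpa [s] using hi)).2
      rcases lt_or_gt_of_ne (left_ne_zero_of_mul (hsign j₀ j₀).ne') with hneg | hp
      · have h1 := hcos x (fun i hi => by
          obtain ⟨-, -, l, hl1, -⟩ := hlow i.val i.2 (by simpa [s] using hi)
          have : r l.val < 0 := by
            by_contra h0
            exact absurd (hsign j₀ l) (not_lt.2
              (mul_nonpos_of_nonpos_of_nonneg hneg.le (not_lt.1 h0)))
          exact (abs_of_pos (pos_of_mul_neg_right hl1 this.le)).symm) hout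
        simp only [← hign] at h1
        exact h1.trans (le_abs_self _)
      · have h1 := hcos (-x) (fun i hi => by
          obtain ⟨-, -, l, hl1, -⟩ := hlow i.val i.2 (by simpa [s] using hi)
          have : 0 < r l.val := by
            by_contra h0
            exact absurd (hsign j₀ l) (not_lt.2
              (mul_nonpos_of_nonneg_of_nonpos hp.le (not_lt.1 h0)))
          exact (abs_of_neg (neg_of_mul_neg_right hl1 this.le)).symm) hout
        simp only [Pi.neg_apply, mul_neg, ← hign] at h1
        exact h1.trans ((cosine_neg_left _ _).le.trans (neg_le_abs _))
  refine ⟨hfirst, fun hω => ?_⟩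
  -- Each product of ignorance and knowledge is the squared knowledge times a positive resolvent
  -- value, or zero.
  have hnonneg : 0 ≤ coverage k V y := by
    refine div_nonneg (Finset.sum_nonneg fun i _ => ?_)
      (mul_nonneg (vnorm_nonneg _) (vnorm_nonneg _))
    by_cases hσi : σ i.val = 0
    · rw [(hnull i hσi).1, zero_mul]
    · rw [hign]
      have := hω i.val (by simp [restSupport, hσi, i.2])
      have h2 := mul_nonneg (mul_self_nonneg (knowledge k V i)) this.le
      simp only [hx]
      linarith
  rwa [abs_of_nonneg hnonneg] at hfirst

end Coverage

end NCD

end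

/-! ### Both bounds for augmentation graphs -/

theorem theorem5 (Nl Nu k : ℕ) (hNl : 0 < Nl) (hNu : 0 < Nu) (hk : 0 < k) (hkN : k < Nl + Nu) :
    -- the error bound
    (∀ (Known S : Type*) [Fintype Known] [MeasurableSpace S] (G : NCD.AugData Nl Nu Known S)
        (_ : ∀ x, 0 < G.degree x)
        (σ : Fin (Nl + Nu) → ℝ) (V : Matrix (NCD.Point Nl Nu) (Fin (Nl + Nu)) ℝ)
        (_ : NCD.IsSpectral G.normAdj σ V)
        (σbar : Fin (Nl + Nu) → ℝ) (Vbar : Matrix (NCD.Point Nl Nu) (Fin (Nl + Nu)) ℝ)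
        (_ : NCD.IsSpectral (NCD.averaged G.normAdj) σbar Vbar)
        (_ : NCD.specNorm (G.normAdj - NCD.averaged G.normAdj)
          < 1 / 2 * (σ ⟨k - 1, by omega⟩ - σ ⟨k, hkN⟩))
        (_ : NCD.labeledMass k σbar Vbar ≠ 0)
        (f : NCD.Point Nl Nu → Fin k → ℝ) (_ : G.IsLearned f)
        (Y : Type*) [Fintype Y] [DecidableEq Y] (label : Fin Nu → Y)
        (_ : ∀ c, (Finset.univ.filter fun x => label x = c).card * Fintype.card Y = Nu)
        (pick : (Y → ℝ) → Y) (_ : ∀ (v : Y → ℝ) (c : Y), v c ≤ v (pick v)),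
        (NCD.probingError pick label f : ℝ) ≤
          2 * (Nu : ℝ) / (Fintype.card Y : ℝ) *
            ∑ c : Y,
              (NCD.ignoranceDegree k Vbar (NCD.labelVec label c) *
                  (1 - NCD.coverage k Vbar (NCD.labelVec label c) ^ 2) +
                2 * (1 + NCD.coverage k Vbar (NCD.labelVec label c) ^ 2 *
                      NCD.ignoranceDegree k Vbar (NCD.labelVec label c) ^ 2 /
                      (((NCD.restSupport k σbar).card : ℝ) * NCD.labeledMass k σbar Vbar)) *
                  (NCD.specNorm (G.normAdj - NCD.averaged G.normAdj) /
                    (σ ⟨k - 1, by omega⟩ - σ ⟨k, hkN⟩)))) ∧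
    -- the lower bound on the coverage
    (∀ g b h τ : ℝ, 0 < g → 0 < b → 0 < h → τ < 1 →
      ∃ C : ℝ, 0 < C ∧
        ∀ (Known S : Type*) [Fintype Known] [MeasurableSpace S] (G : NCD.AugData Nl Nu Known S)
          (_ : ∀ x, 0 < G.degree x)
          (σbar : Fin (Nl + Nu) → ℝ) (Vbar : Matrix (NCD.Point Nl Nu) (Fin (Nl + Nu)) ℝ)
          (_ : NCD.IsSpectral (NCD.averaged G.normAdj) σbar Vbar)
          (_ : NCD.labeledMass k σbar Vbar ≠ 0)
          (d : Fin Nu → ℝ) (Q : Matrix (Fin Nu) (Fin Nu) ℝ)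
          (_ : NCD.IsSpectral (NCD.unlabeledBlock G.normAdj) d Q)
          (_ : h ≤ NCD.etaL G.normAdj)
          (_ : ∀ j, k ≤ j.val + 1 → d j ≤ τ * ((Nl : ℝ) * NCD.etaL G.normAdj))
          (M : ℝ) (_ : 0 < M) (_ : ∀ x, NCD.etaU G.normAdj x ≤ 1 / M) (_ : C ≤ M ^ 2)
          (y : Fin Nu → ℝ) (_ : ∀ x, y x = 0 ∨ y x = 1)
          (_ : NCD.IsGeneric k g b d Q (NCD.etaU G.normAdj) y),
          (1 - C / M ^ 2) * Real.sqrt (1 - τ) *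
              NCD.ratioFloor k d (NCD.eigRatio Q (NCD.etaU G.normAdj) y)
            ≤ |NCD.coverage k Vbar y| ∧
          ((∀ i ∈ NCD.restSupport k σbar,
              0 < NCD.resolventValue d Q (NCD.etaU G.normAdj) y (σbar i)) →
            (1 - C / M ^ 2) * Real.sqrt (1 - τ) *
                NCD.ratioFloor k d (NCD.eigRatio Q (NCD.etaU G.normAdj) y)
              ≤ NCD.coverage k Vbar y)) := by
  refine ⟨?_, ?_⟩
  · intro Known S _ _ G _ σ V hV σbar Vbar hVbar hδ hm f hf Y _ _ label hlabel pick hpick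
    exact NCD.probingError_le_sum hNl hNu G hV hVbar hk hkN hδ hm hf label hlabel hpick
  · intro g b h τ hg hb hh hτ
    have hτ' : 0 < 1 - τ := sub_pos.2 hτ
    have hNl' : (0 : ℝ) < Nl := by exact_mod_cast hNl
    have hNu' : (0 : ℝ) < Nu := by exact_mod_cast hNu
    refine ⟨4 * (Nl * Nu) / g ^ 2 + 2 * Nu / (g * h) + 2 * (2 * Nu / (g * (1 - τ) * h))
      + 2 * (4 * Nu ^ 2 / (g * b * (1 - τ) * h)), by positivity, ?_⟩
    intro Known S _ _ G _ σbar Vbar hVbar hm d Q hQ hη hdτ M hM hηM hCM y hy hgen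
    exact NCD.coverage_lower_bound hNl hNu hk hg hb hh hτ G.normAdj_transpose
      G.normAdj_quadForm_nonneg hVbar hm hQ hη hdτ hM G.etaU_normAdj_nonneg hηM hy hgen rfl hCM
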